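/- **Theorem 3.1 (irregular Poisson summation).** Let $d\ge 1$ and $\varepsilon\ge 0$, and let $D=\Delta+\varepsilon$ on $\mathbb R^d$, where $\Delta=-\sum_j\partial_j^2$ (so $D$ has Fourier symbol $|\xi|^2+\varepsilon$). Write $\hat f(\xi)=(2\pi)^{-d/2}\int f(x)e^{-ix\cdot\xi}\,dx$, and let $\|\cdot\|$ be the norm of $L^2(\mathbb R^d)$. For $\lambda>0$, a *knot set* $\Xi(\lambda)$ is a countable set $\{\xi_\nu\}\subset\mathbb R^d$ that is uniformly discrete ($\inf_{\nu\neq\mu}|\xi_\nu-\xi_\mu|>0$) and for which there are open sets $Q_\nu\subset\mathbb R^d$, pairwise disjoint and of diameter at most $\lambda$, such that $Q_\nu$ contains $\xi_\nu$ and no other point of the set, each closure $\overline{Q_\nu}$ is homeomorphic to a closed ball of $\mathbb R^d$, and the closures $\overline{Q_\nu}$ cover $\mathbb R^d$. For an integer $k>d/2$, the *Lagrangian spline* $L^k_\nu$ is the continuous function $L\in L^2(\mathbb R^d)$ that satisfies $D^kL=\sum_\mu\alpha_\mu\delta_{\xi_\mu}$ in the sense of distributions for some $(\alpha_\mu)\in\ell^2$,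 and $L(\xi_\nu)=1$, $L(\xi_\mu)=0$ for $\mu\ne\nu$. Let $\Lambda^k_\nu\in L^2(\mathbb R^d)$ be the inverse Fourier transform of $L^k_\nu$. There is a constant $c=c(d,\varepsilon)>0$, depending only on $d$ and $\varepsilon$, such that for every $\sigma>0$, every knot set $\Xi(\lambda)$ with $0<\lambda<(c(\sigma+\varepsilon))^{-1}$ and every integer $r\ge[d/2]+1$ the following holds. For every integer $l\ge 0$ and every $\nu$ the spline $L_\nu^{2^lr}$ exists and is unique; and for every $\varphi\in L^2(\mathbb R^d)$ supported in the closed ball of radius $\sigma$ centred at $0$, each of the series below converges unconditionally in $L^2(\mathbb R^d)$, $$\varphi=\lim_{l\to\infty}\sum_{\xi_\nu\in\Xi(\lambda)}\hat\varphi(\xi_\nu)\,\Lambda_\nu^{2^lr}\quad\text{in }L^2(\mathbb R^d),$$ and for every integer $l\ge 0$ $$\Big\|\varphi-\sum_{\xi_\nu\in\Xi(\lambda)}\hat\varphi(\xi_\nu)\,\Lambda_\nu^{2^lr}\Big\|\le 2\,\big(c\,\lambda\,(\sigma+\varepsilon)\big)^{2^{l+1}r}\,\|\varphi\|.$$ 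-/

import Mathlib

open MeasureTheory

namespace IrregularSampling

/-- `ℝ^d` with its Euclidean norm. -/
abbrev Rd (d : ℕ) : Type := EuclideanSpace ℝ (Fin d)

/-- A knot set with mesh parameter `lam`: a countable, uniformly discrete set `X ⊆ ℝ^d` for which there
are open cells `Q x` (`x ∈ X`), pairwise disjoint and of diameter at most `lam`, with closures that are
closed topological balls and cover `ℝ^d`, such that `Q x` contains exactly one point of `X`, namely `x`. -/
structure IsKnotSet {d : ℕ} (X : Set (Rd d)) (lam : ℝ) : Prop where
  countable : X.Countable
  separated : ∃ δ : ℝ, 0 < δ ∧ ∀ x ∈ X, ∀ y ∈ X, x ≠ y → δ ≤ dist x y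
  cells : ∃ Q : Rd d → Set (Rd d),
    (∀ x ∈ X, IsOpen (Q x)) ∧
    (∀ x ∈ X, Q x ∩ X = {x}) ∧
    (∀ x ∈ X, Nonempty (closure (Q x) ≃ₜ Metric.closedBall (0 : Rd d) 1)) ∧
    (∀ x ∈ X, ∀ y ∈ Q x, ∀ z ∈ Q x, dist y z ≤ lam) ∧
    X.PairwiseDisjoint Q ∧
    (⋃ x ∈ X, closure (Q x)) = Set.univ

/-- The operator `D_ε = Δ + ε`, where `Δ = -∑ ∂²/∂x_j²` is the positive Laplacian
(Fourier symbol `|ξ|² + ε`), acting on smooth functions. -/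
noncomputable def opD {d : ℕ} (ε : ℝ) (u : Rd d → ℂ) : Rd d → ℂ :=
  fun x => -(Laplacian.laplacian u x) + (ε : ℂ) * u x

/-- `u` solves `D_ε^k u = ∑_{x ∈ X} α_x δ_x` in the sense of distributions. -/
def SolvesDelta {d : ℕ} (ε : ℝ) (k : ℕ) (X : Set (Rd d)) (α : X → ℂ) (u : Rd d → ℂ) : Prop :=
  ∀ ψ : Rd d → ℂ, ContDiff ℝ (⊤ : ℕ∞) ψ → HasCompactSupport ψ →
    HasSum (fun x : X => α x * ψ x) (∫ y, u y * ((opD ε)^[k] ψ) y)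

/-- `L` is the Lagrangian spline `L_ν^k` of the knot set `X`: the (continuous representative of an)
`L²` solution of `D_ε^k L = ∑_x α_x δ_x` with some `α ∈ ℓ²(X)`, which is `1` at the knot `ν`
and `0` at all the other knots. -/
structure IsLagrangianSpline {d : ℕ} (ε : ℝ) (k : ℕ) (X : Set (Rd d)) (ν : X) (L : Rd d → ℂ) :
    Prop where
  continuous : Continuous L
  memLp : MemLp L 2 (volume : Measure (Rd d))
  solves : ∃ α : X → ℂ, Summable (fun x => ‖α x‖ ^ 2) ∧ SolvesDelta ε k X α L
  apply_self : L ν = 1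
  apply_of_ne : ∀ x : X, x ≠ ν → L x = 0

/-- The Fourier transform `(2π)^{-d/2} ∫ f(x) e^{-i x·ξ} dx` of an integrable function, at a point. -/
noncomputable def fourierAt {d : ℕ} (f : Rd d → ℂ) (ξ : Rd d) : ℂ :=
  (((2 * Real.pi) ^ (-(d : ℝ) / 2) : ℝ) : ℂ) *
    ∫ x, f x * Complex.exp (-Complex.I * ((inner ℝ x ξ : ℝ) : ℂ))

theorem memLp_comp_smul {d : ℕ} {g : Rd d → ℂ} (hg : MemLp g 2 (volume : Measure (Rd d)))
    {a : ℝ} (ha : a ≠ 0) : MemLp (fun x => g (a • x)) 2 (volume : Measure (Rd d)) := by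
  have hm : AEMeasurable (fun x : Rd d => a • x) volume := (measurable_const_smul a).aemeasurable
  refine MemLp.comp_of_map (g := g) ?_ hm
  rw [Measure.map_addHaar_smul _ ha]
  exact hg.smul_measure ENNReal.ofReal_ne_top

/-- The inverse Fourier transform on `L²(ℝ^d)` in the normalization
`(2π)^{-d/2} ∫ g(ξ) e^{i x·ξ} dξ`. Mathlib's `𝓕⁻` has the kernel `e^{2π i x·ξ}`,
hence the dilation by `(2π)⁻¹`. -/
noncomputable def fourierInvL2 {d : ℕ} (g : Lp ℂ 2 (volume : Measure (Rd d))) :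
    Lp ℂ 2 (volume : Measure (Rd d)) :=
  (((2 * Real.pi) ^ (-(d : ℝ) / 2) : ℝ) : ℂ) •
    (memLp_comp_smul (Lp.memLp (FourierTransformInv.fourierInv g))
      (inv_ne_zero Real.two_pi_pos.ne')).toLp _

end IrregularSampling

/-!
Functions on `ℝ^d` are written as `fourierAt F` with a density `F`, and the Sobolev space of order
`k > d/2` is parametrized by `g = ⟨y⟩^k F ∈ L²` (`bracket`, `densityOp`). In this picture the value
at `x` is the pairing with an explicit vector `evalVec x`, and the energy of the spline problem is
`‖q g‖² = ∫ (‖y‖² + ε)^k |F|²` with the multiplier `q = formOp`.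

*Sampling.* The Gram matrix of the evaluation vectors is a Bessel kernel, which decays faster than
any power (`exists_norm_bessel_kernel_le`). Over a uniformly discrete set it passes Schur's test, so
that `R a = ∑ a_x evalVec x` is bounded on `ℓ²` and `R†` samples. Translates of a bump give a bounded
right inverse of `R†` (`exists_sampling_system`).

*Poincaré inequality.* If `fourierAt F` vanishes on a `lam`-dense set, then
`∫ |F|² ≤ (A lam)^{2k} ∫ ‖y‖^{2k} |F|²` for all `k ≥ s > d/2`, with `A` independent of `k`
(`exists_poincare`). At unit scale and `k = s` low frequencies are absorbed by the mean value
inequality and high frequencies are bounded by the Sobolev sampling estimate; dilation gives the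
scale `lam`, and Young's inequality the orders `k ≥ s`.

*Splines.* Hence the energy is coercive on `ker R†` and there is a bounded operator `S` on `ℓ²` that
interpolates samples with energy orthogonal to `ker R†` (`exists_spline_operator`). The Lagrangian
splines are exactly the functions with density `densityOp (S e_ν)`: orthogonality is the
distributional equation, and conversely the transform of the equation shows that each `L²` solution
lies in the Sobolev space of order `k` (`IsLagrangianSpline.exists_density`). In particular the
series of the theorem is the image under a bounded operator of the expansion of an `ℓ²` vector.

*Error.* For `φ = densityOp g` supported in the ball of radius `σ`, the error `n = g - S R† g` lies in
`ker R†`, and `‖q n‖² = ⟪q n, q g⟫ ≤ (σ² + ε)^k ‖densityOp n‖ ‖φ‖`. Together with the Poincaré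
inequality this duality argument gives `‖densityOp n‖ ≤ (A lam)^{2k} (σ² + ε)^k ‖φ‖`, with the full
exponent `2k`.
-/

namespace IrregularSampling

open scoped FourierTransform SchwartzMap ENNReal ContDiff

/-! ### The Fourier transform on `L¹ ∩ L²` -/

theorem two_pi_rpow_sq (d : ℕ) :
    ((2 * Real.pi) ^ (-(d : ℝ) / 2)) ^ 2 = ((2 * Real.pi) ^ d)⁻¹ := by
  rw [← Real.rpow_natCast, ← Real.rpow_mul Real.two_pi_pos.le, ← Real.rpow_natCast,
    ← Real.rpow_neg Real.two_pi_pos.le]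
  congr 1
  push_cast
  ring

theorem quasiMeasurePreserving_smul {d : ℕ} {a : ℝ} (ha : a ≠ 0) :
    Measure.QuasiMeasurePreserving (fun x : Rd d => a • x) volume volume := by
  refine ⟨measurable_const_smul _, ?_⟩
  rw [Measure.map_addHaar_smul _ ha]
  exact Measure.smul_absolutelyContinuous

theorem fourierAt_eq {d : ℕ} (f : Rd d → ℂ) (ξ : Rd d) :
    fourierAt f ξ = (((2 * Real.pi) ^ (-(d : ℝ) / 2) : ℝ) : ℂ) * 𝓕 f ((2 * Real.pi)⁻¹ • ξ) := by
  unfold fourierAt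
  rw [Real.fourier_eq']
  congr 1
  refine integral_congr_ae (Filter.Eventually.of_forall fun x => ?_)
  simp only [smul_eq_mul, inner_smul_right]
  rw [mul_comm]
  congr 2
  have : (2 * Real.pi : ℝ) ≠ 0 := Real.two_pi_pos.ne'
  push_cast
  field_simp

theorem integral_fourier_mul {d : ℕ} {f g : Rd d → ℂ} (hf : Integrable f) (hg : Integrable g) :
    ∫ x, 𝓕 f x * g x = ∫ x, f x * 𝓕 g x := by
  have := VectorFourier.integral_fourierIntegral_smul_eq_flip (μ := volume) (ν := volume)
    (L := innerₗ (Rd d)) Real.continuous_fourierChar continuous_inner hf hg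
  simp only [flip_innerₗ, smul_eq_mul] at this
  exact this

/-- On `L¹ ∩ L²` the Fourier transform of `L²` is given by the Fourier integral. -/
theorem coeFn_fourier_toLp {d : ℕ} {f : Rd d → ℂ} (h1 : Integrable f) (h2 : MemLp f 2) :
    (𝓕 (h2.toLp f) : Lp ℂ 2 (volume : Measure (Rd d))) =ᵐ[volume] 𝓕 f := by
  have hcont : Continuous (𝓕 f) :=
    VectorFourier.fourierIntegral_continuous Real.continuous_fourierChar
      (L := innerₗ (Rd d)) continuous_inner h1
  refine ae_eq_of_integral_contDiff_smul_eq ?_ hcont.locallyIntegrable ?_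
  · exact (Lp.memLp _).locallyIntegrable (by norm_num)
  intro g hg hgs
  have hgs' : HasCompactSupport (fun x => (g x : ℂ)) := hgs.comp_left Complex.ofReal_zero
  have hg' : ContDiff ℝ ∞ (fun x => (g x : ℂ)) := Complex.ofRealCLM.contDiff.comp hg
  let ψ : 𝓢(Rd d, ℂ) := hgs'.toSchwartzMap hg'
  have e1 := congrArg (fun T => T ψ) (Lp.fourier_toTemperedDistribution_eq (h2.toLp f))
  simp only [TemperedDistribution.fourier_apply, Lp.toTemperedDistribution_apply] at e1
  have e2 : ∫ x, g x • (𝓕 (h2.toLp f) : Lp ℂ 2 (volume : Measure (Rd d))) x =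
      ∫ x, ψ x • (𝓕 (h2.toLp f) : Lp ℂ 2 (volume : Measure (Rd d))) x :=
    integral_congr_ae (Filter.Eventually.of_forall fun x => by simp [ψ])
  rw [e2, ← e1]
  have e3 : ∫ x, (𝓕 ψ) x • (h2.toLp f) x = ∫ x, 𝓕 (ψ : Rd d → ℂ) x * f x := by
    refine integral_congr_ae ?_
    filter_upwards [h2.coeFn_toLp] with x hx
    rw [hx, SchwartzMap.fourier_coe, smul_eq_mul]
  rw [e3, integral_fourier_mul ψ.integrable h1]
  exact integral_congr_ae (Filter.Eventually.of_forall fun x => by simp [ψ])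

theorem norm_sq_eq_integral {d : ℕ} (f : Lp ℂ 2 (volume : Measure (Rd d))) :
    ‖f‖ ^ 2 = ∫ x, ‖f x‖ ^ 2 := by
  have h := inner_self_eq_norm_sq_to_K (𝕜 := ℂ) f
  rw [L2.inner_def] at h
  have h2 : ∫ x, inner ℂ (f x) (f x) = ((∫ x, ‖f x‖ ^ 2 : ℝ) : ℂ) := by
    rw [← integral_complex_ofReal]
    refine integral_congr_ae (Filter.Eventually.of_forall fun x => ?_)
    simp only [inner_self_eq_norm_sq_to_K]
    norm_cast
  rw [h2] at h
  apply Complex.ofReal_injective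
  rw [h]
  simp

theorem integral_norm_sq_toLp {d : ℕ} {f : Rd d → ℂ} (hf : MemLp f 2) :
    ‖hf.toLp f‖ ^ 2 = ∫ x, ‖f x‖ ^ 2 := by
  rw [norm_sq_eq_integral]
  refine integral_congr_ae ?_
  filter_upwards [hf.coeFn_toLp] with x hx
  rw [hx]

theorem coeFn_fourierInvL2 {d : ℕ} (g : Lp ℂ 2 (volume : Measure (Rd d))) :
    fourierInvL2 g =ᵐ[volume] fun x => (((2 * Real.pi) ^ (-(d : ℝ) / 2) : ℝ) : ℂ) *
      (𝓕⁻ g : Lp ℂ 2 (volume : Measure (Rd d))) ((2 * Real.pi)⁻¹ • x) := by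
  unfold fourierInvL2
  filter_upwards [Lp.coeFn_smul (((2 * Real.pi) ^ (-(d : ℝ) / 2) : ℝ) : ℂ)
    ((memLp_comp_smul (Lp.memLp (FourierTransformInv.fourierInv g))
      (inv_ne_zero Real.two_pi_pos.ne')).toLp _), (memLp_comp_smul (Lp.memLp
      (FourierTransformInv.fourierInv g)) (inv_ne_zero Real.two_pi_pos.ne')).coeFn_toLp] with x h1 h2
  rw [h1, Pi.smul_apply, h2, smul_eq_mul]

theorem norm_fourierInvL2 {d : ℕ} (g : Lp ℂ 2 (volume : Measure (Rd d))) :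
    ‖fourierInvL2 g‖ = ‖g‖ := by
  have h0 : ‖(𝓕⁻ g : Lp ℂ 2 (volume : Measure (Rd d)))‖ = ‖g‖ := by
    rw [← Lp.norm_fourier_eq (𝓕⁻ g : Lp ℂ 2 (volume : Measure (Rd d))),
      FourierTransform.fourier_fourierInv_eq]
  rw [← sq_eq_sq₀ (norm_nonneg _) (norm_nonneg _), ← h0, norm_sq_eq_integral,
    norm_sq_eq_integral (𝓕⁻ g)]
  have e : ∫ x, ‖fourierInvL2 g x‖ ^ 2 = ∫ x, ((2 * Real.pi) ^ d)⁻¹ *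
      ‖(𝓕⁻ g : Lp ℂ 2 (volume : Measure (Rd d))) ((2 * Real.pi)⁻¹ • x)‖ ^ 2 := by
    refine integral_congr_ae ?_
    filter_upwards [coeFn_fourierInvL2 g] with x hx
    rw [hx, norm_mul, mul_pow, Complex.norm_real, Real.norm_eq_abs, sq_abs, two_pi_rpow_sq]
  rw [e, integral_const_mul, Measure.integral_comp_smul volume
    (fun x => ‖(𝓕⁻ g : Lp ℂ 2 (volume : Measure (Rd d))) x‖ ^ 2)]
  have : (0:ℝ) < (2 * Real.pi) ^ d := by positivity
  simp only [finrank_euclideanSpace, Fintype.card_fin, inv_pow, inv_inv, smul_eq_mul,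
    abs_of_pos this]
  field_simp

theorem fourierInvL2_sub {d : ℕ} (g h : Lp ℂ 2 (volume : Measure (Rd d))) :
    fourierInvL2 (g - h) = fourierInvL2 g - fourierInvL2 h := by
  have hqmp := quasiMeasurePreserving_smul (d := d) (inv_ne_zero Real.two_pi_pos.ne')
  have hs : (𝓕⁻ (g - h) : Lp ℂ 2 (volume : Measure (Rd d))) = 𝓕⁻ g - 𝓕⁻ h :=
    map_sub (FourierTransform.fourierInvCLM ℂ (Lp ℂ 2 (volume : Measure (Rd d)))) g h
  refine Lp.ext ?_
  filter_upwards [coeFn_fourierInvL2 g, coeFn_fourierInvL2 h, coeFn_fourierInvL2 (g - h),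
    Lp.coeFn_sub (fourierInvL2 g) (fourierInvL2 h), hqmp.ae (Lp.coeFn_sub (𝓕⁻ g) (𝓕⁻ h))]
    with x h1 h2 h3 h4 h5
  rw [h3, h4, Pi.sub_apply, h1, h2, hs, h5, Pi.sub_apply]
  ring

theorem fourierInvL2_injective {d : ℕ} :
    Function.Injective (fourierInvL2 : Lp ℂ 2 (volume : Measure (Rd d)) → _) := by
  intro g h hgh
  rw [← sub_eq_zero, ← norm_eq_zero, ← norm_fourierInvL2, fourierInvL2_sub, hgh, sub_self,
    norm_zero]

theorem integrable_comp_smul_two_pi {d : ℕ} {F : Rd d → ℂ} (h1 : Integrable F) :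
    Integrable (fun z => F ((2 * Real.pi) • z)) :=
  h1.comp_smul Real.two_pi_pos.ne'

/-- Up to a dilation of the density, `fourierAt` is the Fourier transform `𝓕`. -/
theorem fourierAt_eq_fourier {d : ℕ} (F : Rd d → ℂ) (x : Rd d) :
    fourierAt F x =
      𝓕 (fun z => (((2 * Real.pi) ^ ((d : ℝ) / 2) : ℝ) : ℂ) * F ((2 * Real.pi) • z)) x := by
  rw [Real.fourier_eq']
  unfold fourierAt
  have hpos : (0:ℝ) < (2 * Real.pi) ^ d := by positivity
  have := Measure.integral_comp_smul (volume : Measure (Rd d))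
    (fun y => (((2 * Real.pi) ^ ((d : ℝ) / 2) : ℝ) : ℂ) *
      (F y * Complex.exp (-Complex.I * ((inner ℝ y x : ℝ) : ℂ)))) (2 * Real.pi)
  have e : ∀ v : Rd d, Complex.exp (((-2 * Real.pi * inner ℝ v x : ℝ) : ℂ) * Complex.I) •
      ((((2 * Real.pi) ^ ((d : ℝ) / 2) : ℝ) : ℂ) * F ((2 * Real.pi) • v)) =
      (((2 * Real.pi) ^ ((d : ℝ) / 2) : ℝ) : ℂ) *
      (F ((2 * Real.pi) • v) *
        Complex.exp (-Complex.I * ((inner ℝ ((2 * Real.pi) • v) x : ℝ) : ℂ))) := by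
    intro v
    rw [inner_smul_left, smul_eq_mul]
    have : ((-2 * Real.pi * inner ℝ v x : ℝ) : ℂ) * Complex.I =
      -Complex.I * (((starRingEnd ℝ) (2 * Real.pi) * inner ℝ v x : ℝ) : ℂ) := by
      simp only [conj_trivial]; push_cast; ring
    rw [this]; ring
  simp_rw [e]
  rw [this, integral_const_mul, finrank_euclideanSpace, Fintype.card_fin, abs_of_pos (by positivity)]
  rw [Complex.real_smul, ← mul_assoc, ← Complex.ofReal_mul]
  congr 2
  rw [← Real.rpow_natCast, ← Real.rpow_neg Real.two_pi_pos.le, ← Real.rpow_add Real.two_pi_pos]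
  congr 1; ring

theorem continuous_fourierAt {d : ℕ} {F : Rd d → ℂ} (h1 : Integrable F) :
    Continuous (fourierAt F) := by
  have hcont : Continuous (𝓕 F) :=
    VectorFourier.fourierIntegral_continuous Real.continuous_fourierChar
      (L := innerₗ (Rd d)) continuous_inner h1
  have : fourierAt F = fun ξ => (((2 * Real.pi) ^ (-(d : ℝ) / 2) : ℝ) : ℂ) *
      𝓕 F ((2 * Real.pi)⁻¹ • ξ) := funext fun ξ => fourierAt_eq F ξ
  rw [this]
  fun_prop

theorem exists_memLp_fourierAt {d : ℕ} {F : Rd d → ℂ} (h1 : Integrable F) (h2 : MemLp F 2) :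
    ∃ h : MemLp (fourierAt F) 2 (volume : Measure (Rd d)),
      fourierInvL2 (h.toLp _) = h2.toLp F := by
  set H : Rd d → ℂ := fun z => (((2 * Real.pi) ^ ((d : ℝ) / 2) : ℝ) : ℂ) * F ((2 * Real.pi) • z)
    with hH
  have hH1 : Integrable H := (integrable_comp_smul_two_pi h1).const_mul _
  have hH2 : MemLp H 2 := (memLp_comp_smul h2 Real.two_pi_pos.ne').const_mul _
  have hae := coeFn_fourier_toLp hH1 hH2
  have hFA : fourierAt F = 𝓕 H := funext fun x => fourierAt_eq_fourier F x
  have hm : MemLp (fourierAt F) 2 (volume : Measure (Rd d)) := by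
    rw [hFA]; exact (memLp_congr_ae hae).1 (Lp.memLp _)
  refine ⟨hm, ?_⟩
  have e1 : hm.toLp _ = 𝓕 (hH2.toLp H) := by
    refine Lp.ext ?_
    filter_upwards [hm.coeFn_toLp, hae] with x h h'
    rw [h, h', hFA]
  have hqmp := quasiMeasurePreserving_smul (d := d) (inv_ne_zero Real.two_pi_pos.ne')
  refine Lp.ext ?_
  filter_upwards [coeFn_fourierInvL2 (hm.toLp _), h2.coeFn_toLp, hqmp.ae hH2.coeFn_toLp]
    with x hx hx2 hx3
  rw [hx, hx2, e1, FourierTransform.fourierInv_fourier_eq, hx3, hH]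
  simp only
  rw [← mul_assoc, ← Complex.ofReal_mul, ← Real.rpow_add Real.two_pi_pos, smul_smul,
    mul_inv_cancel₀ Real.two_pi_pos.ne', one_smul]
  ring_nf
  simp

theorem memLp_fourierAt {d : ℕ} {F : Rd d → ℂ} (h1 : Integrable F) (h2 : MemLp F 2) :
    MemLp (fourierAt F) 2 (volume : Measure (Rd d)) := (exists_memLp_fourierAt h1 h2).1

theorem fourierInvL2_fourierAt {d : ℕ} {F : Rd d → ℂ} (h1 : Integrable F) (h2 : MemLp F 2) :
    fourierInvL2 ((memLp_fourierAt h1 h2).toLp _) = h2.toLp F := (exists_memLp_fourierAt h1 h2).2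

/-- Plancherel's identity for a density in `L¹ ∩ L²`. -/
theorem integral_norm_sq_fourierAt {d : ℕ} {F : Rd d → ℂ} (h1 : Integrable F) (h2 : MemLp F 2) :
    ∫ x, ‖fourierAt F x‖ ^ 2 = ∫ y, ‖F y‖ ^ 2 := by
  rw [← integral_norm_sq_toLp h2, ← fourierInvL2_fourierAt h1 h2, norm_fourierInvL2,
    integral_norm_sq_toLp]

theorem integral_fourierAt_mul {d : ℕ} {f g : Rd d → ℂ} (hf : Integrable f) (hg : Integrable g) :
    ∫ x, fourierAt f x * g x = ∫ x, f x * fourierAt g x := by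
  have e1 : ∫ x, fourierAt f x * g x = (((2 * Real.pi) ^ ((d : ℝ) / 2) : ℝ) : ℂ) *
      ∫ z, f ((2 * Real.pi) • z) * 𝓕 g z := by
    simp_rw [fourierAt_eq_fourier f]
    rw [integral_fourier_mul ((integrable_comp_smul_two_pi hf).const_mul _) hg,
      ← integral_const_mul]
    simp_rw [mul_assoc]
  have e2 : ∀ z : Rd d, f ((2 * Real.pi) • z) * 𝓕 g z =
      (fun y => f y * 𝓕 g ((2 * Real.pi)⁻¹ • y)) ((2 * Real.pi) • z) := by
    intro z
    simp only [smul_smul, inv_mul_cancel₀ Real.two_pi_pos.ne', one_smul]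
  rw [e1, integral_congr_ae (Filter.Eventually.of_forall e2), Measure.integral_comp_smul volume
    (fun y => f y * 𝓕 g ((2 * Real.pi)⁻¹ • y))]
  simp_rw [fourierAt_eq g]
  have hpos : (0:ℝ) < (2 * Real.pi) ^ d := by positivity
  rw [finrank_euclideanSpace, Fintype.card_fin, abs_of_pos (by positivity), Complex.real_smul,
    ← mul_assoc, ← Complex.ofReal_mul, ← integral_const_mul]
  refine integral_congr_ae (Filter.Eventually.of_forall fun y => ?_)
  have : (2 * Real.pi) ^ ((d : ℝ) / 2) * ((2 * Real.pi) ^ d)⁻¹ =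
      (2 * Real.pi) ^ (-(d : ℝ) / 2) := by
    rw [← Real.rpow_natCast, ← Real.rpow_neg Real.two_pi_pos.le,
      ← Real.rpow_add Real.two_pi_pos]
    congr 1; ring
  simp only [this]
  ring

/-- Parseval's identity between an `L²` function and a Schwartz function. -/
theorem integral_mul_eq_fourierInvL2 {d : ℕ} (U : Lp ℂ 2 (volume : Measure (Rd d)))
    (χ : 𝓢(Rd d, ℂ)) : ∫ x, U x * χ x = ∫ y, fourierInvL2 U y * fourierAt χ y := by
  have e1 := congrArg (fun T => T χ) (Lp.fourier_toTemperedDistribution_eq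
    (𝓕⁻ U : Lp ℂ 2 (volume : Measure (Rd d))))
  simp only [TemperedDistribution.fourier_apply, Lp.toTemperedDistribution_apply,
    FourierTransform.fourier_fourierInv_eq, smul_eq_mul] at e1
  have e2 : ∫ x, U x * χ x = ∫ x, χ x * U x := by simp_rw [mul_comm]
  rw [e2, ← e1]
  have e3 : ∫ y, fourierInvL2 U y * fourierAt χ y = ∫ y, (((2 * Real.pi) ^ d)⁻¹ : ℝ) •
      (𝓕 (χ : Rd d → ℂ) ((2 * Real.pi)⁻¹ • y) *
      (𝓕⁻ U : Lp ℂ 2 (volume : Measure (Rd d))) ((2 * Real.pi)⁻¹ • y)) := by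
    refine integral_congr_ae ?_
    filter_upwards [coeFn_fourierInvL2 U] with y hy
    rw [hy, fourierAt_eq, ← two_pi_rpow_sq, Complex.real_smul]
    push_cast
    ring
  rw [e3, integral_smul, Measure.integral_comp_smul volume (fun x => 𝓕 (χ : Rd d → ℂ) x *
      (𝓕⁻ U : Lp ℂ 2 (volume : Measure (Rd d))) x)]
  have : (0:ℝ) < (2 * Real.pi) ^ d := by positivity
  simp only [finrank_euclideanSpace, Fintype.card_fin, inv_pow, inv_inv, abs_of_pos this,
    smul_smul, inv_mul_cancel₀ this.ne', one_smul]
  rfl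

open scoped Laplacian in
/-- The operator `Δ + ε`, with `Δ` the positive Laplacian, on Schwartz functions. -/
noncomputable def opSchwartz {d : ℕ} (ε : ℝ) (ψ : 𝓢(Rd d, ℂ)) : 𝓢(Rd d, ℂ) :=
  -(Δ ψ) + (ε : ℂ) • ψ

theorem coe_opSchwartz {d : ℕ} (ε : ℝ) (ψ : 𝓢(Rd d, ℂ)) :
    (opSchwartz ε ψ : Rd d → ℂ) = opD ε ψ := by
  funext x
  simp [opSchwartz, opD, SchwartzMap.laplacian_apply]

theorem coe_opSchwartz_iterate {d : ℕ} (ε : ℝ) (k : ℕ) (ψ : 𝓢(Rd d, ℂ)) :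
    (((opSchwartz ε)^[k] ψ : 𝓢(Rd d, ℂ)) : Rd d → ℂ) = (opD ε)^[k] ψ := by
  induction k with
  | zero => rfl
  | succ n ih => rw [Function.iterate_succ_apply', Function.iterate_succ_apply', coe_opSchwartz, ih]

theorem fourierAt_opSchwartz {d : ℕ} (ε : ℝ) (ψ : 𝓢(Rd d, ℂ)) (y : Rd d) :
    fourierAt (opSchwartz ε ψ) y = ((‖y‖ ^ 2 + ε : ℝ) : ℂ) * fourierAt ψ y := by
  rw [fourierAt_eq, fourierAt_eq, ← SchwartzMap.fourier_coe, ← SchwartzMap.fourier_coe, opSchwartz,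
    FourierTransform.fourier_add, FourierTransform.fourier_neg, FourierTransform.fourier_smul,
    SchwartzMap.laplacian_eq_fourierMultiplierCLM, SchwartzMap.fourierMultiplierCLM_apply]
  rw [FourierTransform.fourier_smul, FourierTransform.fourier_fourierInv_eq]
  simp only [add_apply, neg_apply, smul_apply]
  rw [SchwartzMap.smulLeftCLM_apply_apply (by fun_prop)]
  simp only [norm_smul, norm_inv, Real.norm_eq_abs, abs_of_pos Real.two_pi_pos,
    Complex.real_smul, smul_eq_mul]
  push_cast
  field_simp

theorem fourierAt_opSchwartz_iterate {d : ℕ} (ε : ℝ) (k : ℕ) (ψ : 𝓢(Rd d, ℂ)) (y : Rd d) :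
    fourierAt ((opSchwartz ε)^[k] ψ) y = (((‖y‖ ^ 2 + ε) ^ k : ℝ) : ℂ) * fourierAt ψ y := by
  induction k with
  | zero => simp
  | succ n ih =>
    rw [Function.iterate_succ_apply', fourierAt_opSchwartz, ih]
    push_cast
    ring

/-! ### Families passing Schur's test, and projections for a form -/

section Frames

variable {H : Type*} [NormedAddCommGroup H] [InnerProductSpace ℂ H] {ι : Type*}

/-- Schur's test for a Gram matrix. -/
theorem norm_sum_smul_sq_le {v : ι → H} {C : ℝ}
    (hv : ∀ (s : Finset ι) (i : ι), ∑ j ∈ s, ‖inner ℂ (v i) (v j)‖ ≤ C) (s : Finset ι)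
    (a : ι → ℂ) : ‖∑ i ∈ s, a i • v i‖ ^ 2 ≤ C * ∑ i ∈ s, ‖a i‖ ^ 2 := by
  have h1 : ‖∑ i ∈ s, a i • v i‖ ^ 2 ≤
      ∑ i ∈ s, ∑ j ∈ s, ‖a i‖ * ‖a j‖ * ‖inner ℂ (v i) (v j)‖ := by
    have e : ‖∑ i ∈ s, a i • v i‖ ^ 2 =
        ‖∑ i ∈ s, ∑ j ∈ s, inner ℂ (a i • v i) (a j • v j)‖ := by
      simp_rw [← inner_sum, ← sum_inner]
      rw [inner_self_eq_norm_sq_to_K]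
      simp
    rw [e]
    refine (norm_sum_le _ _).trans (Finset.sum_le_sum fun i _ => (norm_sum_le _ _).trans
      (Finset.sum_le_sum fun j _ => ?_))
    rw [inner_smul_left, inner_smul_right, norm_mul, norm_mul, RCLike.norm_conj, mul_assoc]
  have h2 : ∑ i ∈ s, ∑ j ∈ s, ‖a i‖ * ‖a j‖ * ‖inner ℂ (v i) (v j)‖ ≤
      ∑ i ∈ s, ∑ j ∈ s, (‖a i‖ ^ 2 / 2 * ‖inner ℂ (v i) (v j)‖ +
        ‖a j‖ ^ 2 / 2 * ‖inner ℂ (v j) (v i)‖) := by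
    refine Finset.sum_le_sum fun i _ => Finset.sum_le_sum fun j _ => ?_
    rw [norm_inner_symm (v j) (v i), ← add_mul]
    refine mul_le_mul_of_nonneg_right ?_ (norm_nonneg _)
    nlinarith [sq_nonneg (‖a i‖ - ‖a j‖)]
  refine h1.trans (h2.trans ?_)
  simp_rw [Finset.sum_add_distrib]
  have h3 : ∑ i ∈ s, ∑ j ∈ s, ‖a i‖ ^ 2 / 2 * ‖inner ℂ (v i) (v j)‖ ≤
      C / 2 * ∑ i ∈ s, ‖a i‖ ^ 2 := by
    rw [Finset.mul_sum]
    refine Finset.sum_le_sum fun i _ => ?_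
    rw [← Finset.mul_sum]
    nlinarith [hv s i, sq_nonneg ‖a i‖]
  rw [Finset.sum_comm (f := fun i j => ‖a j‖ ^ 2 / 2 * ‖inner ℂ (v j) (v i)‖)]
  linarith

/-- Bessel's inequality for a family whose Gram matrix passes Schur's test. -/
theorem sum_norm_inner_sq_le {v : ι → H} {C : ℝ} (hC : 0 ≤ C)
    (hv : ∀ (s : Finset ι) (i : ι), ∑ j ∈ s, ‖inner ℂ (v i) (v j)‖ ≤ C) (s : Finset ι)
    (g : H) : ∑ i ∈ s, ‖inner ℂ (v i) g‖ ^ 2 ≤ C * ‖g‖ ^ 2 := by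
  set A := ∑ i ∈ s, ‖inner ℂ (v i) g‖ ^ 2 with hA
  have hA0 : 0 ≤ A := by positivity
  have e : (A : ℂ) = inner ℂ (∑ i ∈ s, (inner ℂ (v i) g) • v i) g := by
    rw [sum_inner, hA]
    push_cast
    refine Finset.sum_congr rfl fun i _ => ?_
    rw [inner_smul_left, Complex.conj_mul']
  have h1 : A ≤ ‖∑ i ∈ s, (inner ℂ (v i) g) • v i‖ * ‖g‖ := by
    have : ‖(A : ℂ)‖ = A := by rw [Complex.norm_real, Real.norm_of_nonneg hA0]
    rw [← this, e]
    exact norm_inner_le_norm _ _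
  have h2 := norm_sum_smul_sq_le hv s (fun i => inner ℂ (v i) g)
  rw [← hA] at h2
  rcases hA0.eq_or_lt with h | h
  · rw [← h]; positivity
  · have h3 : A * A ≤ (C * ‖g‖ ^ 2) * A := by
      calc A * A ≤ (‖∑ i ∈ s, (inner ℂ (v i) g) • v i‖ * ‖g‖) *
          (‖∑ i ∈ s, (inner ℂ (v i) g) • v i‖ * ‖g‖) :=
            mul_le_mul h1 h1 hA0 (by positivity)
        _ = ‖∑ i ∈ s, (inner ℂ (v i) g) • v i‖ ^ 2 * ‖g‖ ^ 2 := by ring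
        _ ≤ (C * A) * ‖g‖ ^ 2 := mul_le_mul_of_nonneg_right h2 (by positivity)
        _ = _ := by ring
    exact le_of_mul_le_mul_right h3 h

variable [CompleteSpace H]

theorem summable_norm_sq_lp (a : lp (fun _ : ι => ℂ) 2) : Summable fun i => ‖a i‖ ^ 2 := by
  have := (lp.memℓp a).summable (by norm_num)
  simpa using this

theorem norm_sq_lp (a : lp (fun _ : ι => ℂ) 2) : ‖a‖ ^ 2 = ∑' i, ‖a i‖ ^ 2 := by
  have := lp.norm_rpow_eq_tsum (p := 2) (by norm_num) a
  simpa using this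

theorem summable_smul_of_schur {v : ι → H} {C : ℝ}
    (hv : ∀ (s : Finset ι) (i : ι), ∑ j ∈ s, ‖inner ℂ (v i) (v j)‖ ≤ C)
    (a : lp (fun _ : ι => ℂ) 2) : Summable fun i => a i • v i := by
  rw [summable_iff_vanishing_norm]
  intro e he
  by_cases hC : C ≤ 0
  · refine ⟨∅, fun t _ => ?_⟩
    have := norm_sum_smul_sq_le hv t a
    have h0 : ‖∑ i ∈ t, a i • v i‖ ^ 2 ≤ 0 :=
      this.trans (mul_nonpos_of_nonpos_of_nonneg hC (by positivity))
    have : ‖∑ i ∈ t, a i • v i‖ = 0 := by nlinarith [norm_nonneg (∑ i ∈ t, a i • v i)]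
    rw [this]; exact he
  · push Not at hC
    obtain ⟨s, hs⟩ := summable_iff_vanishing_norm.1 (summable_norm_sq_lp a) (e ^ 2 / C)
      (by positivity)
    refine ⟨s, fun t ht => ?_⟩
    have h1 := hs t ht
    rw [Real.norm_of_nonneg (by positivity), lt_div_iff₀ hC] at h1
    have := norm_sum_smul_sq_le hv t a
    refine lt_of_pow_lt_pow_left₀ 2 he.le ?_
    linarith

/-- A family whose Gram matrix passes Schur's test has a bounded synthesis operator on `ℓ²`. -/
theorem exists_synthesis {v : ι → H} {C : ℝ} (hC : 0 ≤ C)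
    (hv : ∀ (s : Finset ι) (i : ι), ∑ j ∈ s, ‖inner ℂ (v i) (v j)‖ ≤ C) :
    ∃ R : lp (fun _ : ι => ℂ) 2 →L[ℂ] H, ∀ a, HasSum (fun i => a i • v i) (R a) := by
  have hs := summable_smul_of_schur hv
  let R₀ : lp (fun _ : ι => ℂ) 2 →ₗ[ℂ] H :=
    { toFun := fun a => ∑' i, a i • v i
      map_add' := fun a b => by
        rw [← (hs a).tsum_add (hs b)]
        simp [add_smul]
      map_smul' := fun c a => by
        rw [RingHom.id_apply, ← (hs a).tsum_const_smul]
        simp [mul_smul] }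
  refine ⟨R₀.mkContinuous (√C) fun a => ?_, fun a => (hs a).hasSum⟩
  have h1 : ‖R₀ a‖ ^ 2 ≤ C * ‖a‖ ^ 2 := by
    have ht : Filter.Tendsto (fun s : Finset ι => ‖∑ i ∈ s, a i • v i‖ ^ 2) Filter.atTop
      (nhds (‖R₀ a‖ ^ 2)) := ((hs a).hasSum.norm).pow 2
    refine le_of_tendsto ht (Filter.Eventually.of_forall fun s => ?_)
    refine (norm_sum_smul_sq_le hv s a).trans (mul_le_mul_of_nonneg_left ?_ hC)
    rw [norm_sq_lp]
    exact (summable_norm_sq_lp a).sum_le_tsum s fun _ _ => by positivity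
  rw [← Real.sqrt_sq (norm_nonneg a), ← Real.sqrt_mul hC]
  exact Real.le_sqrt_of_sq_le h1

/-- The adjoint of the synthesis operator samples: its coordinates are the pairings with the
vectors of the family. -/
theorem adjoint_synthesis_apply {v : ι → H} {R : lp (fun _ : ι => ℂ) 2 →L[ℂ] H}
    (hR : ∀ a, HasSum (fun i => a i • v i) (R a)) (g : H) (i : ι) :
    (ContinuousLinearMap.adjoint R g) i = inner ℂ (v i) g := by
  classical
  have e : R (lp.single 2 i (1 : ℂ)) = v i := by
    refine (hR _).unique ?_
    convert! hasSum_ite_eq i (v i) using 2 with j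
    by_cases h : j = i
    · subst h; simp
    · simp [h]
  rw [← e, ← ContinuousLinearMap.adjoint_inner_right, lp.inner_single_left]
  simp

end Frames

section Spline

variable {H E : Type*} [NormedAddCommGroup H] [InnerProductSpace ℂ H] [CompleteSpace H]
  [NormedAddCommGroup E] [NormedSpace ℂ E]

/-- The projection onto `ker T` that is orthogonal for the form `⟪q ·, q ·⟫`, which is only
assumed to be coercive on `ker T`. -/
theorem exists_form_projection (T : H →L[ℂ] E) (q : H →L[ℂ] H) {C : NNReal}
    (hC : ∀ n, T n = 0 → ‖n‖ ≤ C * ‖q n‖) :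
    ∃ P : H →L[ℂ] H, (∀ h, T (P h) = 0) ∧
      ∀ h n, T n = 0 → inner ℂ (q n) (q (P h)) = inner ℂ (q n) (q h) := by
  let N : Submodule ℂ H := T.ker
  have hNc : IsClosed (N : Set H) := T.isClosed_ker
  have : CompleteSpace N := hNc.completeSpace_coe
  let qN : N →L[ℂ] H := q.comp N.subtypeL
  have hanti : AntilipschitzWith C qN := by
    refine AddMonoidHomClass.antilipschitz_of_bound qN fun n => ?_
    exact hC n n.2
  have hcl : IsClosed (Set.range qN) := hanti.isClosed_range qN.uniformContinuous
  let e := qN.equivRange hanti.injective hcl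
  have hcl' : IsClosed (qN.range : Set H) := by
    rw [LinearMap.coe_range]; exact hcl
  have : CompleteSpace qN.range := hcl'.completeSpace_coe
  refine ⟨N.subtypeL.comp ((e.symm : qN.range →L[ℂ] N).comp
    ((qN.range).orthogonalProjectionOnto.comp q)), fun h => ?_, fun h n hn => ?_⟩
  · exact (e.symm ((qN.range).orthogonalProjectionOnto (q h))).2
  · have e1 : q ((e.symm ((qN.range).orthogonalProjectionOnto (q h)) : N) : H) =
        ((qN.range).orthogonalProjectionOnto (q h) : H) := by
      have := congrArg Subtype.val (e.apply_symm_apply ((qN.range).orthogonalProjectionOnto (q h)))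
      exact this
    simp only [ContinuousLinearMap.comp_apply, Submodule.subtypeL_apply,
      ContinuousLinearEquiv.coe_coe]
    rw [e1]
    have hmem : q n ∈ qN.range := ⟨⟨n, hn⟩, rfl⟩
    exact (Submodule.inner_orthogonalProjectionOnto_eq_of_mem_left ⟨q n, hmem⟩ (q h))

end Spline

/-! ### Decay of the Bessel kernel and sums over discrete sets -/

theorem integrable_inv_one_add_norm_sq_pow {d N : ℕ} (hN : d < 2 * N) :
    Integrable (fun y : Rd d => ((1 + ‖y‖ ^ 2) ^ N)⁻¹) := by
  have h := integrable_rpow_neg_one_add_norm_sq (E := Rd d) (μ := volume) (r := 2 * N)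
    (by rw [finrank_euclideanSpace, Fintype.card_fin]; exact_mod_cast hN)
  refine h.congr (Filter.Eventually.of_forall fun y => ?_)
  have : -(2 * (N : ℝ)) / 2 = -(N : ℝ) := by ring
  simp only [this]
  rw [Real.rpow_neg (by positivity), Real.rpow_natCast]

theorem one_add_norm_sq_le_mul {d : ℕ} (a b : Rd d) :
    1 + ‖a + b‖ ^ 2 ≤ 2 * (1 + ‖a‖ ^ 2) * (1 + ‖b‖ ^ 2) := by
  have h := norm_add_le a b
  have h2 : ‖a + b‖ ^ 2 ≤ (‖a‖ + ‖b‖) ^ 2 := by gcongr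
  nlinarith [sq_nonneg (‖a‖ - ‖b‖), sq_nonneg (‖a‖ * ‖b‖)]

/-- The weight `(1 + ‖x‖²)^{-N}`, `2N > d`, sums uniformly over points that stay within bounded
distance of a uniformly discrete family. -/
theorem exists_sum_inv_pow_le (d N : ℕ) (hN : d < 2 * N) {δ R : ℝ} (hδ : 0 < δ) (hR : 0 ≤ R) :
    ∃ C : ℝ, 0 ≤ C ∧ ∀ {ι : Type} (p z : ι → Rd d), (∀ i j, i ≠ j → δ ≤ dist (p i) (p j)) →
      (∀ i, dist (z i) (p i) ≤ R) → ∀ (s : Finset ι) (x : Rd d),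
        ∑ i ∈ s, ((1 + ‖z i - x‖ ^ 2) ^ N)⁻¹ ≤ C := by
  set M : ℝ := 2 * (1 + (R + δ) ^ 2) with hM
  have hM0 : 0 < M := by positivity
  set W : ℝ := ∫ y : Rd d, ((1 + ‖y‖ ^ 2) ^ N)⁻¹ with hW
  have hW0 : 0 ≤ W := integral_nonneg fun y => by positivity
  set V : ℝ := volume.real (Metric.ball (0 : Rd d) (δ / 2)) with hV
  have hV0 : 0 < V := by
    rw [hV, measureReal_def]
    exact ENNReal.toReal_pos (Metric.measure_ball_pos volume _ (by positivity)).ne'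
      measure_ball_lt_top.ne
  refine ⟨V⁻¹ * (M ^ N * W), by positivity, fun {ι} p z hp hz s x => ?_⟩
  have hint : Integrable (fun y : Rd d => ((1 + ‖y - x‖ ^ 2) ^ N)⁻¹) :=
    (integrable_inv_one_add_norm_sq_pow hN).comp_sub_right x
  have key : ∀ i, ((1 + ‖z i - x‖ ^ 2) ^ N)⁻¹ * V ≤
      M ^ N * ∫ y in Metric.ball (p i) (δ / 2), ((1 + ‖y - x‖ ^ 2) ^ N)⁻¹ := by
    intro i
    have hVi : volume.real (Metric.ball (p i) (δ / 2)) = V := by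
      rw [hV, measureReal_def, measureReal_def, Measure.addHaar_ball_center]
    rw [← integral_const_mul, ← hVi, mul_comm, ← smul_eq_mul, ← setIntegral_const]
    refine setIntegral_mono_on (integrableOn_const measure_ball_lt_top.ne)
      (hint.integrableOn.const_mul _) measurableSet_ball fun y hy => ?_
    have h1 := one_add_norm_sq_le_mul (z i - x) (y - z i)
    have h2 : ‖y - z i‖ ≤ R + δ := by
      rw [← dist_eq_norm]
      have := dist_triangle y (p i) (z i)
      rw [dist_comm (p i)] at this
      have hy' := Metric.mem_ball.1 hy
      linarith [hz i]
    have h3 : 1 + ‖y - x‖ ^ 2 ≤ M * (1 + ‖z i - x‖ ^ 2) := by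
      have e : z i - x + (y - z i) = y - x := by abel
      rw [e] at h1
      have : ‖y - z i‖ ^ 2 ≤ (R + δ) ^ 2 := by gcongr
      nlinarith [sq_nonneg ‖z i - x‖]
    rw [← div_eq_mul_inv, inv_le_comm₀ (by positivity) (by positivity), inv_div,
      div_le_iff₀ (by positivity), mul_comm, ← mul_pow]
    gcongr
  have hdisj : Set.PairwiseDisjoint (s : Set ι) fun i => Metric.ball (p i) (δ / 2) := by
    intro i _ j _ hij
    refine Metric.ball_disjoint_ball ?_
    linarith [hp i j hij]
  have hsum : ∑ i ∈ s, ∫ y in Metric.ball (p i) (δ / 2), ((1 + ‖y - x‖ ^ 2) ^ N)⁻¹ ≤ W := by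
    rw [← integral_biUnion_finset s (fun i _ => measurableSet_ball) hdisj
      fun i _ => hint.integrableOn]
    refine (setIntegral_le_integral hint (Filter.Eventually.of_forall fun y => ?_)).trans ?_
    · simp only [Pi.zero_apply]; positivity
    · rw [integral_sub_right_eq_self (fun y : Rd d => ((1 + ‖y‖ ^ 2) ^ N)⁻¹) x]
  have h4 : (∑ i ∈ s, ((1 + ‖z i - x‖ ^ 2) ^ N)⁻¹) * V ≤ M ^ N * W := by
    rw [Finset.sum_mul]
    refine (Finset.sum_le_sum fun i _ => key i).trans ?_
    rw [← Finset.mul_sum]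
    gcongr
  rw [inv_mul_eq_div, le_div_iff₀ hV0]
  exact h4

theorem one_add_pow_le_factorial_mul_exp {u : ℝ} (hu : 0 ≤ u) (N : ℕ) :
    (1 + u) ^ N ≤ N.factorial * Real.exp (1 + u) := by
  have := Real.pow_div_factorial_le_exp (1 + u) (by positivity) N
  rw [div_le_iff₀ (by positivity)] at this
  linarith

theorem norm_integral_gaussian_exp_inner {d : ℕ} {t : ℝ} (ht : 0 < t) (x : Rd d) :
    ‖∫ y : Rd d, ((Real.exp (-(t * ‖y‖ ^ 2)) : ℝ) : ℂ) *
      Complex.exp (Complex.I * ((inner ℝ x y : ℝ) : ℂ))‖ =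
      (Real.pi / t) ^ ((d : ℝ) / 2) * Real.exp (-(‖x‖ ^ 2 / (4 * t))) := by
  have h := GaussianFourier.integral_cexp_neg_mul_sq_norm_add (V := Rd d) (b := (t : ℂ))
    (by simpa using ht) Complex.I x
  have e : ∀ y : Rd d, ((Real.exp (-(t * ‖y‖ ^ 2)) : ℝ) : ℂ) *
      Complex.exp (Complex.I * ((inner ℝ x y : ℝ) : ℂ)) =
      Complex.exp (-(t : ℂ) * ‖y‖ ^ 2 + Complex.I * ((inner ℝ x y : ℝ) : ℂ)) := by
    intro y
    rw [Complex.ofReal_exp, ← Complex.exp_add]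
    push_cast
    ring_nf
  simp_rw [e]
  rw [h, norm_mul]
  congr 1
  · rw [← Complex.ofReal_div, finrank_euclideanSpace, Fintype.card_fin]
    rw [show ((d : ℂ) / 2) = (((d : ℝ) / 2 : ℝ) : ℂ) by push_cast; rfl,
      ← Complex.ofReal_cpow (by positivity), Complex.norm_real, Real.norm_of_nonneg (by positivity)]
  · rw [Complex.norm_exp]
    congr 1
    rw [Complex.I_sq]
    have : (-1 * (‖x‖ : ℂ) ^ 2 / (4 * (t : ℂ))) = ((-(‖x‖ ^ 2 / (4 * t)) : ℝ) : ℂ) := by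
      push_cast; ring
    rw [this, Complex.ofReal_re]

/-- The Bessel kernel, the Fourier transform of `(1 + ‖y‖²)^{-k}`, decays faster than any power:
the Gamma integral writes `(1 + ‖y‖²)^{-k}` as a mixture of Gaussians. -/
theorem exists_norm_bessel_kernel_le (d k N : ℕ) (hk : d < 2 * k) :
    ∃ C : ℝ, 0 ≤ C ∧ ∀ x : Rd d, ‖∫ y : Rd d, ((((1 + ‖y‖ ^ 2) ^ k)⁻¹ : ℝ) : ℂ) *
      Complex.exp (Complex.I * ((inner ℝ x y : ℝ) : ℂ))‖ ≤ C * ((1 + ‖x‖ ^ 2) ^ N)⁻¹ := by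
  have hk0 : (0 : ℝ) < k := by
    have : 0 < k := by omega
    exact_mod_cast this
  set G : ℝ := Real.Gamma k with hG
  have hG0 : 0 < G := Real.Gamma_pos_of_pos hk0
  -- the constant in `e^{-u} (1 + u)^N (1 + 4t)^N ≤ B e^{t/2}`
  set B : ℝ := N.factorial * Real.exp 1 * (8 ^ N * (N.factorial * Real.exp 1)) with hB
  set D : ℝ := ∫ t in Set.Ioi (0 : ℝ), t ^ ((k : ℝ) - 1 - d / 2) * Real.exp (-(1 / 2) * t) with hD
  have hs : -1 < (k : ℝ) - 1 - d / 2 := by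
    have : (d : ℝ) < 2 * k := by exact_mod_cast hk
    linarith
  have hDint : IntegrableOn (fun t : ℝ => t ^ ((k : ℝ) - 1 - d / 2) * Real.exp (-(1 / 2) * t))
      (Set.Ioi 0) := by
    have := integrableOn_rpow_mul_exp_neg_mul_rpow hs one_pos (b := 1 / 2) (by norm_num)
    simpa using this
  have hD0 : 0 ≤ D := setIntegral_nonneg measurableSet_Ioi fun t ht => by
    have : (0:ℝ) < t := ht
    positivity
  refine ⟨G⁻¹ * (Real.pi ^ ((d : ℝ) / 2) * B * D), by positivity, fun x => ?_⟩
  have hgam : ∀ y : Rd d, ((1 + ‖y‖ ^ 2) ^ k)⁻¹ =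
      G⁻¹ * ∫ t in Set.Ioi (0 : ℝ), t ^ ((k : ℝ) - 1) * Real.exp (-((1 + ‖y‖ ^ 2) * t)) := by
    intro y
    rw [Real.integral_rpow_mul_exp_neg_mul_Ioi hk0 (by positivity), one_div,
      Real.inv_rpow (by positivity), Real.rpow_natCast, mul_comm, mul_assoc,
      mul_inv_cancel₀ hG0.ne', mul_one]
  have hgint : ∀ y : Rd d, IntegrableOn
      (fun t : ℝ => t ^ ((k : ℝ) - 1) * Real.exp (-((1 + ‖y‖ ^ 2) * t))) (Set.Ioi 0) := by
    intro y
    have := integrableOn_rpow_mul_exp_neg_mul_rpow (s := (k : ℝ) - 1) (by linarith) one_pos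
      (b := 1 + ‖y‖ ^ 2) (by positivity)
    simpa only [Real.rpow_one, neg_mul] using this
  set Φ : Rd d → ℝ → ℂ := fun y t =>
    ((t ^ ((k : ℝ) - 1) * Real.exp (-((1 + ‖y‖ ^ 2) * t)) : ℝ) : ℂ) *
      Complex.exp (Complex.I * ((inner ℝ x y : ℝ) : ℂ)) with hΦ
  have hnexp : ∀ y : Rd d, ‖Complex.exp (Complex.I * ((inner ℝ x y : ℝ) : ℂ))‖ = 1 := fun y => by
    rw [mul_comm, Complex.norm_exp_ofReal_mul_I]
  have hΦint : Integrable (Function.uncurry Φ)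
      ((volume : Measure (Rd d)).prod (volume.restrict (Set.Ioi (0 : ℝ)))) := by
    have hmeas : Measurable (Function.uncurry Φ) := by
      have h1 : Measurable fun p : Rd d × ℝ => p.2 ^ ((k : ℝ) - 1) :=
        measurable_snd.pow_const _
      have h2 : Continuous fun p : Rd d × ℝ => Real.exp (-((1 + ‖p.1‖ ^ 2) * p.2)) := by fun_prop
      have h3 : Continuous fun p : Rd d × ℝ =>
        Complex.exp (Complex.I * ((inner ℝ x p.1 : ℝ) : ℂ)) := by fun_prop
      exact (Complex.measurable_ofReal.comp (h1.mul h2.measurable)).mul h3.measurable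
    rw [integrable_prod_iff hmeas.aestronglyMeasurable]
    refine ⟨Filter.Eventually.of_forall fun y => ?_, ?_⟩
    · exact ((hgint y).ofReal (𝕜 := ℂ)).mul_const
        (Complex.exp (Complex.I * ((inner ℝ x y : ℝ) : ℂ)))
    · have e : ∀ y : Rd d, ∫ t in Set.Ioi (0:ℝ), ‖Function.uncurry Φ (y, t)‖ =
          G * ((1 + ‖y‖ ^ 2) ^ k)⁻¹ := by
        intro y
        rw [hgam, ← mul_assoc, mul_inv_cancel₀ hG0.ne', one_mul]
        refine setIntegral_congr_fun measurableSet_Ioi fun t ht => ?_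
        have ht' : (0:ℝ) < t := ht
        simp only [Function.uncurry, hΦ]
        rw [norm_mul, hnexp, mul_one, Complex.norm_real, Real.norm_of_nonneg (by positivity)]
      simp_rw [e]
      exact (integrable_inv_one_add_norm_sq_pow hk).const_mul _
  have hswap : ∫ y : Rd d, ((((1 + ‖y‖ ^ 2) ^ k)⁻¹ : ℝ) : ℂ) *
      Complex.exp (Complex.I * ((inner ℝ x y : ℝ) : ℂ)) =
      ((G⁻¹ : ℝ) : ℂ) * ∫ t in Set.Ioi (0 : ℝ), ∫ y : Rd d, Φ y t := by
    rw [← integral_integral_swap hΦint, ← integral_const_mul]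
    refine integral_congr_ae (Filter.Eventually.of_forall fun y => ?_)
    simp only [hΦ]
    rw [hgam, integral_mul_const, integral_complex_ofReal]
    push_cast
    ring
  rw [hswap, norm_mul, Complex.norm_real, Real.norm_of_nonneg (by positivity), mul_assoc]
  refine mul_le_mul_of_nonneg_left ?_ (by positivity)
  have hle : ∀ t ∈ Set.Ioi (0:ℝ), ‖∫ y : Rd d, Φ y t‖ ≤
      Real.pi ^ ((d : ℝ) / 2) * B * ((1 + ‖x‖ ^ 2) ^ N)⁻¹ *
        (t ^ ((k : ℝ) - 1 - d / 2) * Real.exp (-(1 / 2) * t)) := by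
    intro t ht
    have ht' : (0:ℝ) < t := ht
    have e : ∀ y : Rd d, Φ y t = ((t ^ ((k : ℝ) - 1) * Real.exp (-t) : ℝ) : ℂ) *
        (((Real.exp (-(t * ‖y‖ ^ 2)) : ℝ) : ℂ) *
        Complex.exp (Complex.I * ((inner ℝ x y : ℝ) : ℂ))) := by
      intro y
      simp only [hΦ]
      rw [show -((1 + ‖y‖ ^ 2) * t) = -t + -(t * ‖y‖ ^ 2) by ring, Real.exp_add]
      push_cast
      ring
    simp_rw [e]
    rw [integral_const_mul, norm_mul, norm_integral_gaussian_exp_inner ht', Complex.norm_real,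
      Real.norm_of_nonneg (by positivity), Real.div_rpow Real.pi_pos.le ht'.le,
      Real.rpow_sub ht' _ ((d : ℝ) / 2)]
    set u : ℝ := ‖x‖ ^ 2 / (4 * t) with hu
    have hu0 : 0 ≤ u := by positivity
    have h1 : (1 + ‖x‖ ^ 2) ≤ (1 + u) * (1 + 4 * t) := by
      have : u * (4 * t) = ‖x‖ ^ 2 := by rw [hu]; field_simp
      nlinarith
    have h2 : (1 + ‖x‖ ^ 2) ^ N ≤ (1 + u) ^ N * (1 + 4 * t) ^ N := by
      rw [← mul_pow]; gcongr
    have h3 := one_add_pow_le_factorial_mul_exp hu0 N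
    have h4 : (1 + 4 * t) ^ N ≤ 8 ^ N * (N.factorial * (Real.exp 1 * Real.exp (t / 2))) := by
      have h5 := one_add_pow_le_factorial_mul_exp (u := t / 2) (by positivity) N
      rw [Real.exp_add] at h5
      calc (1 + 4 * t) ^ N ≤ (8 * (1 + t / 2)) ^ N := by gcongr; linarith
        _ = 8 ^ N * (1 + t / 2) ^ N := mul_pow _ _ _
        _ ≤ _ := by gcongr
    have h6 : Real.exp (-u) ≤ B * Real.exp (t / 2) * ((1 + ‖x‖ ^ 2) ^ N)⁻¹ := by
      rw [← div_eq_mul_inv, le_div_iff₀ (by positivity)]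
      calc Real.exp (-u) * (1 + ‖x‖ ^ 2) ^ N
          ≤ Real.exp (-u) * ((N.factorial * Real.exp (1 + u)) *
            (8 ^ N * (N.factorial * (Real.exp 1 * Real.exp (t / 2))))) := by
              refine mul_le_mul_of_nonneg_left (h2.trans ?_) (by positivity)
              gcongr
        _ = (Real.exp (-u) * Real.exp u) * (B * Real.exp (t / 2)) := by
              rw [hB, Real.exp_add]; ring
        _ = B * Real.exp (t / 2) := by rw [← Real.exp_add]; simp
    calc t ^ ((k : ℝ) - 1) * Real.exp (-t) * (Real.pi ^ ((d : ℝ) / 2) / t ^ ((d : ℝ) / 2) *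
          Real.exp (-u)) ≤ t ^ ((k : ℝ) - 1) * Real.exp (-t) *
          (Real.pi ^ ((d : ℝ) / 2) / t ^ ((d : ℝ) / 2) *
          (B * Real.exp (t / 2) * ((1 + ‖x‖ ^ 2) ^ N)⁻¹)) := by gcongr
      _ = Real.pi ^ ((d : ℝ) / 2) * B * ((1 + ‖x‖ ^ 2) ^ N)⁻¹ *
          (t ^ ((k : ℝ) - 1) / t ^ ((d : ℝ) / 2) * (Real.exp (-t) * Real.exp (t / 2))) := by ring
      _ = _ := by
          rw [← Real.exp_add]
          congr 3
          ring
  refine (norm_integral_le_of_norm_le (hDint.const_mul _)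
    ((ae_restrict_iff' measurableSet_Ioi).2 (Filter.Eventually.of_forall hle))).trans ?_
  rw [integral_const_mul]
  exact le_of_eq (by ring)

/-! ### Evaluation vectors -/

/-- The Japanese bracket `⟨y⟩ = (1 + ‖y‖²)^{1/2}`. -/
noncomputable def bracket {d : ℕ} (y : Rd d) : ℝ := √(1 + ‖y‖ ^ 2)

theorem bracket_pos {d : ℕ} (y : Rd d) : 0 < bracket y := Real.sqrt_pos.2 (by positivity)

theorem one_le_bracket {d : ℕ} (y : Rd d) : 1 ≤ bracket y :=
  Real.one_le_sqrt.2 (by nlinarith [sq_nonneg ‖y‖])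

theorem bracket_sq {d : ℕ} (y : Rd d) : bracket y ^ 2 = 1 + ‖y‖ ^ 2 :=
  Real.sq_sqrt (by positivity)

theorem bracket_pow_sq {d : ℕ} (k : ℕ) (y : Rd d) : (bracket y ^ k) ^ 2 = (1 + ‖y‖ ^ 2) ^ k := by
  rw [← bracket_sq, ← pow_mul, ← pow_mul, mul_comm]

theorem continuous_bracket {d : ℕ} : Continuous (bracket : Rd d → ℝ) := by
  unfold bracket; fun_prop

theorem continuous_inv_bracket_pow {d : ℕ} (k : ℕ) :
    Continuous fun y : Rd d => (bracket y ^ k)⁻¹ :=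
  (continuous_bracket.pow k).inv₀ fun y => (pow_pos (bracket_pos y) k).ne'

/-- The function representing evaluation at `x`: the pairing with `⟨y⟩^k F` in `L²` is the value
at `x` of `fourierAt F`. -/
noncomputable def evalFun {d : ℕ} (k : ℕ) (x y : Rd d) : ℂ :=
  (((2 * Real.pi) ^ (-(d : ℝ) / 2) * (bracket y ^ k)⁻¹ : ℝ) : ℂ) *
    Complex.exp (Complex.I * ((inner ℝ x y : ℝ) : ℂ))

theorem continuous_evalFun {d : ℕ} (k : ℕ) (x : Rd d) : Continuous (evalFun k x) := by
  unfold evalFun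
  have h := continuous_inv_bracket_pow (d := d) k
  fun_prop

theorem memLp_evalFun {d k : ℕ} (hk : d < 2 * k) (x : Rd d) :
    MemLp (evalFun k x) 2 (volume : Measure (Rd d)) := by
  rw [memLp_two_iff_integrable_sq_norm (continuous_evalFun k x).aestronglyMeasurable]
  refine ((integrable_inv_one_add_norm_sq_pow hk).const_mul
    (((2 * Real.pi) ^ (-(d : ℝ) / 2)) ^ 2)).congr (Filter.Eventually.of_forall fun y => ?_)
  simp only [evalFun]
  rw [norm_mul, Complex.norm_exp_I_mul_ofReal, mul_one, Complex.norm_real, Real.norm_eq_abs, sq_abs,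
    mul_pow, inv_pow, bracket_pow_sq]

/-- The vector of `L²` representing evaluation at `x` on the Sobolev space of order `k > d/2`. -/
noncomputable def evalVec {d k : ℕ} (hk : d < 2 * k) (x : Rd d) :
    Lp ℂ 2 (volume : Measure (Rd d)) := (memLp_evalFun hk x).toLp _

theorem conj_evalFun {d : ℕ} (k : ℕ) (x y : Rd d) : (starRingEnd ℂ) (evalFun k x y) =
    (((2 * Real.pi) ^ (-(d : ℝ) / 2) * (bracket y ^ k)⁻¹ : ℝ) : ℂ) *
      Complex.exp (-Complex.I * ((inner ℝ y x : ℝ) : ℂ)) := by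
  unfold evalFun
  rw [map_mul, Complex.conj_ofReal, ← Complex.exp_conj, map_mul, Complex.conj_I,
    Complex.conj_ofReal, real_inner_comm]

theorem inner_evalVec {d k : ℕ} (hk : d < 2 * k) (x : Rd d)
    (g : Lp ℂ 2 (volume : Measure (Rd d))) :
    inner ℂ (evalVec hk x) g = fourierAt (fun y => (((bracket y ^ k)⁻¹ : ℝ) : ℂ) * g y) x := by
  rw [L2.inner_def, fourierAt, ← integral_const_mul]
  refine integral_congr_ae ?_
  filter_upwards [(memLp_evalFun hk x).coeFn_toLp] with y hy
  rw [evalVec, hy, RCLike.inner_apply, conj_evalFun]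
  push_cast
  ring

theorem inner_evalVec_evalVec {d k : ℕ} (hk : d < 2 * k) (x x' : Rd d) :
    inner ℂ (evalVec hk x) (evalVec hk x') = ((((2 * Real.pi) ^ d)⁻¹ : ℝ) : ℂ) *
      ∫ y : Rd d, ((((1 + ‖y‖ ^ 2) ^ k)⁻¹ : ℝ) : ℂ) *
      Complex.exp (Complex.I * ((inner ℝ (x' - x) y : ℝ) : ℂ)) := by
  rw [L2.inner_def, ← integral_const_mul]
  refine integral_congr_ae ?_
  filter_upwards [(memLp_evalFun hk x).coeFn_toLp, (memLp_evalFun hk x').coeFn_toLp] with y hy hy'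
  rw [evalVec, evalVec, hy, hy', RCLike.inner_apply, conj_evalFun, ← two_pi_rpow_sq,
    ← bracket_pow_sq, inner_sub_left]
  have : Complex.exp (Complex.I * ((inner ℝ x' y - inner ℝ x y : ℝ) : ℂ)) =
      Complex.exp (Complex.I * ((inner ℝ x' y : ℝ) : ℂ)) *
      Complex.exp (-Complex.I * ((inner ℝ y x : ℝ) : ℂ)) := by
    rw [← Complex.exp_add, real_inner_comm x y]
    congr 1
    push_cast
    ring
  rw [this, evalFun]
  push_cast
  ring

/-- Evaluation vectors at points near a uniformly discrete family pass Schur's test. -/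
theorem exists_schur_evalVec {d k : ℕ} (hk : d < 2 * k) {δ R : ℝ} (hδ : 0 < δ) (hR : 0 ≤ R) :
    ∃ C : ℝ, 0 ≤ C ∧ ∀ {ι : Type} (p z : ι → Rd d), (∀ i j, i ≠ j → δ ≤ dist (p i) (p j)) →
      (∀ i, dist (z i) (p i) ≤ R) → ∀ (s : Finset ι) (i : ι),
        ∑ j ∈ s, ‖inner ℂ (evalVec hk (z i)) (evalVec hk (z j))‖ ≤ C := by
  obtain ⟨C₁, hC₁, h1⟩ := exists_norm_bessel_kernel_le d k k hk
  obtain ⟨C₂, hC₂, h2⟩ := exists_sum_inv_pow_le d k hk hδ hR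
  refine ⟨((2 * Real.pi) ^ d)⁻¹ * (C₁ * C₂), by positivity, fun {ι} p z hp hz s i => ?_⟩
  calc ∑ j ∈ s, ‖inner ℂ (evalVec hk (z i)) (evalVec hk (z j))‖
      ≤ ∑ j ∈ s, ((2 * Real.pi) ^ d)⁻¹ * (C₁ * ((1 + ‖z j - z i‖ ^ 2) ^ k)⁻¹) := by
        refine Finset.sum_le_sum fun j _ => ?_
        rw [inner_evalVec_evalVec, norm_mul, Complex.norm_real, Real.norm_of_nonneg (by positivity)]
        gcongr
        exact h1 _
    _ ≤ _ := by
        rw [← Finset.mul_sum, ← Finset.mul_sum]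
        gcongr
        exact h2 p z hp hz s _

theorem memLp_bracket_mul {d k : ℕ} {F : Rd d → ℂ} (hF : AEStronglyMeasurable F volume)
    (hF2 : Integrable fun y => (1 + ‖y‖ ^ 2) ^ k * ‖F y‖ ^ 2) :
    MemLp (fun y => ((bracket y ^ k : ℝ) : ℂ) * F y) 2 (volume : Measure (Rd d)) := by
  have hm : AEStronglyMeasurable (fun y => ((bracket y ^ k : ℝ) : ℂ) * F y) volume :=
    (Complex.continuous_ofReal.comp (continuous_bracket.pow k)).aestronglyMeasurable.mul hF
  rw [memLp_two_iff_integrable_sq_norm hm]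
  refine hF2.congr (Filter.Eventually.of_forall fun y => ?_)
  simp only
  rw [norm_mul, Complex.norm_real, mul_pow, Real.norm_eq_abs, sq_abs, bracket_pow_sq]

theorem inner_evalVec_toLp {d k : ℕ} (hk : d < 2 * k) {F : Rd d → ℂ}
    (h : MemLp (fun y => ((bracket y ^ k : ℝ) : ℂ) * F y) 2 (volume : Measure (Rd d)))
    (x : Rd d) : inner ℂ (evalVec hk x) (h.toLp _) = fourierAt F x := by
  rw [inner_evalVec, fourierAt, fourierAt]
  congr 1
  refine integral_congr_ae ?_
  filter_upwards [h.coeFn_toLp] with y hy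
  have : ((bracket y ^ k : ℝ) : ℂ) ≠ 0 := by exact_mod_cast (pow_pos (bracket_pos y) k).ne'
  rw [hy, Complex.ofReal_inv, inv_mul_cancel_left₀ this]

/-- Sampling at points near a uniformly discrete family is bounded on the Sobolev space of order
`k > d/2`, with a constant independent of the points. -/
theorem exists_sum_norm_fourierAt_sq_le {d k : ℕ} (hk : d < 2 * k) {δ R : ℝ} (hδ : 0 < δ)
    (hR : 0 ≤ R) :
    ∃ C : ℝ, 0 ≤ C ∧ ∀ {ι : Type} (p z : ι → Rd d), (∀ i j, i ≠ j → δ ≤ dist (p i) (p j)) →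
      (∀ i, dist (z i) (p i) ≤ R) → ∀ (F : Rd d → ℂ), AEStronglyMeasurable F volume →
        Integrable (fun y => (1 + ‖y‖ ^ 2) ^ k * ‖F y‖ ^ 2) → ∀ s : Finset ι,
        ∑ i ∈ s, ‖fourierAt F (z i)‖ ^ 2 ≤ C * ∫ y, (1 + ‖y‖ ^ 2) ^ k * ‖F y‖ ^ 2 := by
  obtain ⟨C, hC, h⟩ := exists_schur_evalVec hk hδ hR
  refine ⟨C, hC, fun {ι} p z hp hz F hF hF2 s => ?_⟩
  have hm := memLp_bracket_mul hF hF2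
  have := sum_norm_inner_sq_le hC (h p z hp hz) s (hm.toLp _)
  simp only [inner_evalVec_toLp, integral_norm_sq_toLp] at this
  refine this.trans (le_of_eq ?_)
  congr 1
  refine integral_congr_ae (Filter.Eventually.of_forall fun y => ?_)
  simp only
  rw [norm_mul, Complex.norm_real, mul_pow, Real.norm_eq_abs, sq_abs, bracket_pow_sq]

theorem integrable_of_integrable_weight {d k : ℕ} (hk : d < 2 * k) {F : Rd d → ℂ}
    (hF : AEStronglyMeasurable F volume)
    (hF2 : Integrable fun y => (1 + ‖y‖ ^ 2) ^ k * ‖F y‖ ^ 2) : Integrable F := by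
  refine (((integrable_inv_one_add_norm_sq_pow hk).add hF2)).mono' hF
    (Filter.Eventually.of_forall fun y => ?_)
  simp only [Pi.add_apply]
  have h0 : 0 < (1 + ‖y‖ ^ 2) ^ k := by positivity
  refine le_of_mul_le_mul_left ?_ h0
  rw [mul_add, mul_inv_cancel₀ h0.ne']
  nlinarith [sq_nonneg ((1 + ‖y‖ ^ 2) ^ k * ‖F y‖ - 1), mul_nonneg h0.le (norm_nonneg (F y))]

theorem memLp_of_integrable_weight {d k : ℕ} {F : Rd d → ℂ}
    (hF : AEStronglyMeasurable F volume)
    (hF2 : Integrable fun y => (1 + ‖y‖ ^ 2) ^ k * ‖F y‖ ^ 2) :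
    MemLp F 2 (volume : Measure (Rd d)) := by
  rw [memLp_two_iff_integrable_sq_norm hF]
  refine hF2.mono' (hF.norm.pow 2) (Filter.Eventually.of_forall fun y => ?_)
  rw [Real.norm_of_nonneg (by positivity)]
  exact le_mul_of_one_le_left (by positivity)
    (one_le_pow₀ (by nlinarith [sq_nonneg ‖y‖]))

/-! ### Differences of Fourier integrals, and separated subsets -/

theorem integrable_mul_exp_inner {d : ℕ} {F : Rd d → ℂ} (hF : Integrable F) (x : Rd d) :
    Integrable fun y => F y * Complex.exp (-Complex.I * ((inner ℝ y x : ℝ) : ℂ)) := by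
  have hc : Continuous fun y : Rd d => Complex.exp (-Complex.I * ((inner ℝ y x : ℝ) : ℂ)) := by
    fun_prop
  refine hF.norm.mono' (hF.aestronglyMeasurable.mul hc.aestronglyMeasurable)
    (Filter.Eventually.of_forall fun y => ?_)
  rw [norm_mul, mul_comm (-Complex.I), mul_neg, ← neg_mul, ← Complex.ofReal_neg,
    Complex.norm_exp_ofReal_mul_I, mul_one]

theorem fourierAt_add {d : ℕ} {F G : Rd d → ℂ} (hF : Integrable F) (hG : Integrable G)
    (x : Rd d) : fourierAt (fun y => F y + G y) x = fourierAt F x + fourierAt G x := by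
  unfold fourierAt
  rw [← mul_add, ← integral_add (integrable_mul_exp_inner hF x) (integrable_mul_exp_inner hG x)]
  simp_rw [add_mul]

theorem fourierAt_const_mul {d : ℕ} (c : ℂ) (F : Rd d → ℂ) (x : Rd d) :
    fourierAt (fun y => c * F y) x = c * fourierAt F x := by
  unfold fourierAt
  simp_rw [mul_assoc]
  rw [integral_const_mul]
  ring

theorem fourierAt_sum {d : ℕ} {ι : Type*} (s : Finset ι) {F : ι → Rd d → ℂ}
    (hF : ∀ i ∈ s, Integrable (F i)) (x : Rd d) :
    fourierAt (fun y => ∑ i ∈ s, F i y) x = ∑ i ∈ s, fourierAt (F i) x := by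
  unfold fourierAt
  rw [← Finset.mul_sum, ← integral_finsetSum s fun i hi => integrable_mul_exp_inner (hF i hi) x]
  simp_rw [Finset.sum_mul]

theorem hasDerivAt_fourierAt_line {d : ℕ} {F : Rd d → ℂ} (hF : Integrable F)
    (hF1 : Integrable fun y => (‖y‖ : ℂ) * F y) (x u : Rd d) (t : ℝ) :
    HasDerivAt (fun τ : ℝ => fourierAt F (x + τ • u))
      (-Complex.I * fourierAt (fun y => ((inner ℝ y u : ℝ) : ℂ) * F y) (x + t • u)) t := by
  unfold fourierAt
  have hc : ∀ z : Rd d,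
      Continuous fun y : Rd d => Complex.exp (-Complex.I * ((inner ℝ y z : ℝ) : ℂ)) := by
    intro z; fun_prop
  have hu : Continuous fun y : Rd d => ((inner ℝ y u : ℝ) : ℂ) := by fun_prop
  have hnexp : ∀ r : ℝ, ‖Complex.exp (-Complex.I * (r : ℂ))‖ = 1 := fun r => by
    rw [mul_comm (-Complex.I), mul_neg, ← neg_mul, ← Complex.ofReal_neg,
      Complex.norm_exp_ofReal_mul_I]
  have key := hasDerivAt_integral_of_dominated_loc_of_deriv_le (μ := (volume : Measure (Rd d)))
    (F := fun (τ : ℝ) y => F y * Complex.exp (-Complex.I * ((inner ℝ y (x + τ • u) : ℝ) : ℂ)))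
    (F' := fun (τ : ℝ) y => -Complex.I * (((inner ℝ y u : ℝ) : ℂ) * F y *
      Complex.exp (-Complex.I * ((inner ℝ y (x + τ • u) : ℝ) : ℂ)))) (x₀ := t)
    (bound := fun y => ‖u‖ * ‖(‖y‖ : ℂ) * F y‖) Filter.univ_mem
    (Filter.Eventually.of_forall fun τ => hF.aestronglyMeasurable.mul (hc _).aestronglyMeasurable)
    (integrable_mul_exp_inner hF _)
    (((hu.aestronglyMeasurable.mul hF.aestronglyMeasurable).mul
      (hc _).aestronglyMeasurable).const_mul _)
    (Filter.Eventually.of_forall fun y τ _ => ?_) (hF1.norm.const_mul _)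
    (Filter.Eventually.of_forall fun y τ _ => ?_)
  · have := (key.2).const_mul (((2 * Real.pi) ^ (-(d : ℝ) / 2) : ℝ) : ℂ)
    convert! this using 1
    rw [integral_const_mul]
    ring
  · rw [norm_mul, norm_mul, norm_mul, norm_mul, hnexp]
    simp only [norm_neg, Complex.norm_I, one_mul, mul_one, Complex.norm_real, norm_norm]
    have := norm_inner_le_norm (𝕜 := ℝ) y u
    calc ‖inner ℝ y u‖ * ‖F y‖ ≤ (‖y‖ * ‖u‖) * ‖F y‖ := by gcongr
      _ = _ := by ring
  · have h1 : HasDerivAt (fun τ : ℝ => inner ℝ y (x + τ • u)) (inner ℝ y u) τ := by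
      simp only [inner_add_right, inner_smul_right]
      simpa using ((hasDerivAt_id τ).mul_const (inner ℝ y u)).const_add (inner ℝ y x)
    have h2 := ((h1.ofReal_comp.const_mul (-Complex.I)).cexp).const_mul (F y)
    convert! h2 using 1
    ring

theorem abs_coord_le_norm {d : ℕ} (y : Rd d) (j : Fin d) : |y j| ≤ ‖y‖ := by
  simpa using PiLp.norm_apply_le y j

/-- The mean value inequality on the segment from `x` to `x + u`, with the gradient evaluated at the
point `z` of the segment where it is largest. -/
theorem exists_norm_fourierAt_sub_sq_le {d : ℕ} {F : Rd d → ℂ} (hF : Integrable F)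
    (hF1 : Integrable fun y => (‖y‖ : ℂ) * F y) (x u : Rd d) :
    ∃ z : Rd d, dist z x ≤ ‖u‖ ∧ ‖fourierAt F (x + u) - fourierAt F x‖ ^ 2 ≤
      ‖u‖ ^ 2 * (d * ∑ j, ‖fourierAt (fun y => ((y j : ℝ) : ℂ) * F y) z‖ ^ 2) := by
  have hFj : ∀ j : Fin d, Integrable fun y : Rd d => ((y j : ℝ) : ℂ) * F y := by
    intro j
    have hc : Continuous fun y : Rd d => ((y j : ℝ) : ℂ) := by fun_prop
    refine hF1.norm.mono' (hc.aestronglyMeasurable.mul hF.aestronglyMeasurable)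
      (Filter.Eventually.of_forall fun y => ?_)
    rw [norm_mul, norm_mul, Complex.norm_real, Complex.norm_real, norm_norm]
    exact mul_le_mul_of_nonneg_right (abs_coord_le_norm y j) (norm_nonneg _)
  set G : Rd d → ℝ := fun z => ∑ j, ‖fourierAt (fun y => ((y j : ℝ) : ℂ) * F y) z‖ with hG
  have hGc : Continuous G := continuous_finsetSum _ fun j _ => (continuous_fourierAt (hFj j)).norm
  obtain ⟨t₀, ht₀, hmax⟩ := (isCompact_Icc (a := (0:ℝ)) (b := 1)).exists_isMaxOn
    ⟨0, by simp⟩ (f := fun t : ℝ => G (x + t • u)) (by fun_prop)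
  refine ⟨x + t₀ • u, ?_, ?_⟩
  · rw [dist_eq_norm, add_sub_cancel_left, norm_smul, Real.norm_of_nonneg ht₀.1]
    exact mul_le_of_le_one_left (norm_nonneg _) ht₀.2
  have hbound : ∀ t ∈ Set.Icc (0:ℝ) 1,
      ‖-Complex.I * fourierAt (fun y => ((inner ℝ y u : ℝ) : ℂ) * F y) (x + t • u)‖ ≤
      ‖u‖ * G (x + t₀ • u) := by
    intro t ht
    have e : (fun y : Rd d => ((inner ℝ y u : ℝ) : ℂ) * F y) =
        fun y => ∑ j, (u j : ℂ) * (((y j : ℝ) : ℂ) * F y) := by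
      funext y
      rw [PiLp.inner_apply]
      push_cast
      rw [Finset.sum_mul]
      refine Finset.sum_congr rfl fun j _ => ?_
      simp only [RCLike.inner_apply, conj_trivial, Complex.ofReal_mul]
      ring
    rw [norm_mul, norm_neg, Complex.norm_I, one_mul, e,
      fourierAt_sum _ fun j _ => (hFj j).const_mul _]
    simp_rw [fourierAt_const_mul]
    calc _ ≤ ∑ j, ‖u‖ * ‖fourierAt (fun y => ((y j : ℝ) : ℂ) * F y) (x + t • u)‖ := by
          refine (norm_sum_le _ _).trans (Finset.sum_le_sum fun j _ => ?_)
          rw [norm_mul, Complex.norm_real]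
          exact mul_le_mul_of_nonneg_right (abs_coord_le_norm u j) (norm_nonneg _)
      _ = ‖u‖ * G (x + t • u) := by rw [← Finset.mul_sum]
      _ ≤ _ := mul_le_mul_of_nonneg_left (hmax ht) (norm_nonneg _)
  have h1 := norm_image_sub_le_of_norm_deriv_le_segment_01'
    (f := fun τ : ℝ => fourierAt F (x + τ • u))
    (fun t _ => (hasDerivAt_fourierAt_line hF hF1 x u t).hasDerivWithinAt)
    (fun t ht => hbound t ⟨ht.1, ht.2.le⟩)
  simp only [one_smul, zero_smul, add_zero] at h1
  have h2 : G (x + t₀ • u) ^ 2 ≤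
      d * ∑ j, ‖fourierAt (fun y => ((y j : ℝ) : ℂ) * F y) (x + t₀ • u)‖ ^ 2 := by
    have := sq_sum_le_card_mul_sum_sq (s := (Finset.univ : Finset (Fin d)))
      (f := fun j => ‖fourierAt (fun y => ((y j : ℝ) : ℂ) * F y) (x + t₀ • u)‖)
    simpa using this
  calc _ ≤ (‖u‖ * G (x + t₀ • u)) ^ 2 := by gcongr
    _ = ‖u‖ ^ 2 * G (x + t₀ • u) ^ 2 := mul_pow _ _ _
    _ ≤ _ := by gcongr

/-- A subset of `X` that is `1`-separated and still relatively dense. -/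
theorem exists_separated_subset {d : ℕ} {X : Set (Rd d)} (hX : ∀ x, ∃ p ∈ X, dist x p ≤ 1) :
    ∃ P ⊆ X, (∀ p ∈ P, ∀ q ∈ P, p ≠ q → 1 ≤ dist p q) ∧ ∀ x, ∃ p ∈ P, dist x p ≤ 2 := by
  obtain ⟨P, hP⟩ := zorn_subset {N | N ⊆ X ∧ Metric.IsSeparated 1 N} (by
    intro c hc hchain
    refine ⟨⋃₀ c, ⟨Set.sUnion_subset fun s hs => (hc hs).1, ?_⟩, fun s hs =>
      Set.subset_sUnion_of_mem hs⟩
    exact (Set.pairwise_sUnion hchain.directedOn).2 fun s hs => (hc hs).2)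
  refine ⟨P, hP.prop.1, fun p hp q hq hpq => ?_, fun x => ?_⟩
  · have : 1 < edist p q := hP.prop.2 hp hq hpq
    rw [edist_dist] at this
    rw [← ENNReal.ofReal_one, ENNReal.ofReal_lt_ofReal_iff_of_nonneg zero_le_one] at this
    exact this.le
  · obtain ⟨y, hy, hxy⟩ := hX x
    have hcov := Metric.IsCover.of_maximal_isSeparated (ε := 1) hP
    obtain ⟨p, hp, hyp⟩ := hcov hy
    refine ⟨p, hp, ?_⟩
    have h1 : dist y p ≤ 1 := by
      have : edist y p ≤ 1 := hyp
      rw [edist_dist, ← ENNReal.ofReal_one] at this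
      exact (ENNReal.ofReal_le_ofReal_iff zero_le_one).1 this
    linarith [dist_triangle x y p]

/-! ### The Poincaré inequality at unit scale -/

/-- If the samples of `f` on each translate `P + u`, `‖u‖ ≤ 2`, of a `2`-dense countable set `P` are
square summable with bound `K`, then integration over `u` bounds the `L²` norm of `f`. -/
theorem integral_norm_sq_le_of_sum_translates {d : ℕ} {f : Rd d → ℂ} (hf : Continuous f)
    {P : Set (Rd d)} (hPc : P.Countable) (hP : ∀ x, ∃ p ∈ P, dist x p ≤ 2) {K : ℝ} (hK : 0 ≤ K)
    (h : ∀ u ∈ Metric.closedBall (0 : Rd d) 2, ∀ s : Finset P, ∑ p ∈ s, ‖f (p + u)‖ ^ 2 ≤ K) :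
    ∫ x, ‖f x‖ ^ 2 ≤ volume.real (Metric.closedBall (0 : Rd d) 2) * K := by
  have : Countable P := hPc.to_subtype
  have hcov : (⋃ p : P, Metric.closedBall (p : Rd d) 2) = Set.univ := by
    refine Set.eq_univ_of_forall fun x => ?_
    obtain ⟨p, hp, hxp⟩ := hP x
    exact Set.mem_iUnion.2 ⟨⟨p, hp⟩, hxp⟩
  have hmeas : ∀ p : P, Measurable fun u : Rd d => ENNReal.ofReal (‖f (p + u)‖ ^ 2) := by
    intro p
    refine ENNReal.measurable_ofReal.comp (Continuous.measurable ?_)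
    fun_prop
  have h1 : ∫⁻ x, ENNReal.ofReal (‖f x‖ ^ 2) ≤
      ENNReal.ofReal (volume.real (Metric.closedBall (0 : Rd d) 2) * K) := by
    calc ∫⁻ x, ENNReal.ofReal (‖f x‖ ^ 2)
        = ∫⁻ x in ⋃ p : P, Metric.closedBall (p : Rd d) 2, ENNReal.ofReal (‖f x‖ ^ 2) := by
          rw [hcov, setLIntegral_univ]
      _ ≤ ∑' p : P, ∫⁻ x in Metric.closedBall (p : Rd d) 2, ENNReal.ofReal (‖f x‖ ^ 2) :=
          lintegral_iUnion_le _ _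
      _ = ∑' p : P, ∫⁻ u in Metric.closedBall (0 : Rd d) 2,
            ENNReal.ofReal (‖f (p + u)‖ ^ 2) := by
          congr 1
          funext p
          have hmp := measurePreserving_add_left (volume : Measure (Rd d)) (p : Rd d)
          have hpre : (fun u : Rd d => (p : Rd d) + u) ⁻¹' Metric.closedBall (p : Rd d) 2 =
              Metric.closedBall 0 2 := by
            ext u; simp
          rw [← hpre, hmp.setLIntegral_comp_preimage Metric.isClosed_closedBall.measurableSet
            (f := fun x => ENNReal.ofReal (‖f x‖ ^ 2))
            (ENNReal.measurable_ofReal.comp (hf.norm.pow 2).measurable)]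
      _ = ∫⁻ u in Metric.closedBall (0 : Rd d) 2, ∑' p : P, ENNReal.ofReal (‖f (p + u)‖ ^ 2) := by
          rw [lintegral_tsum fun p => (hmeas p).aemeasurable]
      _ ≤ ∫⁻ _ in Metric.closedBall (0 : Rd d) 2, ENNReal.ofReal K := by
          refine setLIntegral_mono measurable_const fun u hu => ?_
          refine ENNReal.summable.tsum_le_of_sum_le fun s => ?_
          rw [← ENNReal.ofReal_sum_of_nonneg fun _ _ => by positivity]
          exact ENNReal.ofReal_le_ofReal (h u hu s)
      _ = _ := by
          rw [setLIntegral_const, ENNReal.ofReal_mul measureReal_nonneg, mul_comm,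
            ofReal_measureReal measure_closedBall_lt_top.ne]
  have hm : AEStronglyMeasurable (fun x => ‖f x‖ ^ 2) (volume : Measure (Rd d)) :=
    (hf.norm.pow 2).aestronglyMeasurable
  rw [integral_eq_lintegral_of_nonneg_ae (Filter.Eventually.of_forall fun _ => by positivity)
    hm]
  exact ENNReal.toReal_le_of_le_ofReal (by positivity) h1

theorem integrable_norm_pow_mul {d k : ℕ} {F : Rd d → ℂ} (hF : AEStronglyMeasurable F volume)
    (hF2 : Integrable fun y => (1 + ‖y‖ ^ 2) ^ k * ‖F y‖ ^ 2) :
    Integrable fun y => ‖y‖ ^ (2 * k) * ‖F y‖ ^ 2 := by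
  refine hF2.mono' (AEStronglyMeasurable.mul (by fun_prop) (hF.norm.pow 2))
    (Filter.Eventually.of_forall fun y => ?_)
  rw [Real.norm_of_nonneg (by positivity), pow_mul]
  gcongr
  linarith

theorem integrable_norm_sq {d k : ℕ} {F : Rd d → ℂ} (hF : AEStronglyMeasurable F volume)
    (hF2 : Integrable fun y => (1 + ‖y‖ ^ 2) ^ k * ‖F y‖ ^ 2) :
    Integrable fun y => ‖F y‖ ^ 2 :=
  (memLp_two_iff_integrable_sq_norm hF).1 (memLp_of_integrable_weight hF hF2)

/-- The increments of `fourierAt F` over separated points are small, with a factor `ρ²`, when `F`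
only has frequencies `‖y‖ ≤ ρ`. -/
theorem exists_sum_low_frequency_le {d s : ℕ} (hs : d < 2 * s) :
    ∃ C : ℝ, 0 ≤ C ∧ ∀ {ι : Type} (p : ι → Rd d), (∀ i j, i ≠ j → 1 ≤ dist (p i) (p j)) →
      ∀ (F : Rd d → ℂ), AEStronglyMeasurable F volume → (Integrable fun y => ‖F y‖ ^ 2) →
      ∀ ρ : ℝ, 0 ≤ ρ → ρ ≤ 1 → (∀ y, ρ < ‖y‖ → F y = 0) →
      ∀ u : Rd d, ‖u‖ ≤ 2 → ∀ t : Finset ι,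
        ∑ i ∈ t, ‖fourierAt F (p i + u) - fourierAt F (p i)‖ ^ 2 ≤
          C * ρ ^ 2 * ∫ y, ‖F y‖ ^ 2 := by
  obtain ⟨C, hC, h⟩ := exists_sum_norm_fourierAt_sq_le hs one_pos (zero_le_two (α := ℝ))
  refine ⟨4 * d * (d * (C * 2 ^ s)), by positivity,
    fun {ι} p hp F hF hF0 ρ hρ0 hρ1 hsupp u hu t => ?_⟩
  have hle : ∀ y : Rd d, (1 + ‖y‖ ^ 2) ^ s * ‖F y‖ ^ 2 ≤ 2 ^ s * ‖F y‖ ^ 2 := by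
    intro y
    by_cases hy : ρ < ‖y‖
    · simp [hsupp y hy]
    · push Not at hy
      have : 1 + ‖y‖ ^ 2 ≤ 2 := by nlinarith [norm_nonneg y]
      gcongr
  have hw : Integrable fun y => (1 + ‖y‖ ^ 2) ^ s * ‖F y‖ ^ 2 := by
    refine (hF0.const_mul (2 ^ s)).mono' (AEStronglyMeasurable.mul (by fun_prop) (hF.norm.pow 2))
      (Filter.Eventually.of_forall fun y => ?_)
    rw [Real.norm_of_nonneg (by positivity)]
    exact hle y
  have hF1 : Integrable F := integrable_of_integrable_weight hs hF hw
  have hFy : Integrable fun y => (‖y‖ : ℂ) * F y := by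
    refine hF1.norm.mono' (AEStronglyMeasurable.mul (by fun_prop) hF)
      (Filter.Eventually.of_forall fun y => ?_)
    rw [norm_mul, Complex.norm_real, norm_norm]
    by_cases hy : ρ < ‖y‖
    · simp [hsupp y hy]
    · push Not at hy
      exact mul_le_of_le_one_left (norm_nonneg _) (hy.trans hρ1)
  choose z hz1 hz2 using fun i => exists_norm_fourierAt_sub_sq_le hF1 hFy (p i) u
  have hlej : ∀ (j : Fin d) (y : Rd d), (1 + ‖y‖ ^ 2) ^ s * ‖((y j : ℝ) : ℂ) * F y‖ ^ 2 ≤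
      2 ^ s * ρ ^ 2 * ‖F y‖ ^ 2 := by
    intro j y
    by_cases hy : ρ < ‖y‖
    · simp [hsupp y hy]
    · push Not at hy
      rw [norm_mul, mul_pow, Complex.norm_real, Real.norm_eq_abs]
      have h1 : |y j| ^ 2 ≤ ρ ^ 2 := by
        have := (abs_coord_le_norm y j).trans hy
        gcongr
      calc (1 + ‖y‖ ^ 2) ^ s * (|y j| ^ 2 * ‖F y‖ ^ 2)
          = |y j| ^ 2 * ((1 + ‖y‖ ^ 2) ^ s * ‖F y‖ ^ 2) := by ring
        _ ≤ ρ ^ 2 * (2 ^ s * ‖F y‖ ^ 2) :=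
            mul_le_mul h1 (hle y) (by positivity) (by positivity)
        _ = _ := by ring
  have hmj : ∀ j : Fin d, AEStronglyMeasurable (fun y : Rd d => ((y j : ℝ) : ℂ) * F y) volume :=
    fun j => AEStronglyMeasurable.mul (by fun_prop) hF
  have hwj : ∀ j : Fin d,
      Integrable fun y : Rd d => (1 + ‖y‖ ^ 2) ^ s * ‖((y j : ℝ) : ℂ) * F y‖ ^ 2 := by
    intro j
    refine (hF0.const_mul (2 ^ s * ρ ^ 2)).mono'
      (AEStronglyMeasurable.mul (by fun_prop) ((hmj j).norm.pow 2))
      (Filter.Eventually.of_forall fun y => ?_)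
    rw [Real.norm_of_nonneg (by positivity)]
    exact hlej j y
  calc ∑ i ∈ t, ‖fourierAt F (p i + u) - fourierAt F (p i)‖ ^ 2
      ≤ ∑ i ∈ t, 4 * (d * ∑ j, ‖fourierAt (fun y => ((y j : ℝ) : ℂ) * F y) (z i)‖ ^ 2) := by
        refine Finset.sum_le_sum fun i _ => (hz2 i).trans ?_
        have : ‖u‖ ^ 2 ≤ 4 := by nlinarith [norm_nonneg u]
        gcongr
    _ = 4 * (d * ∑ j, ∑ i ∈ t, ‖fourierAt (fun y => ((y j : ℝ) : ℂ) * F y) (z i)‖ ^ 2) := by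
        rw [← Finset.mul_sum, ← Finset.mul_sum, Finset.sum_comm]
    _ ≤ 4 * (d * ∑ _j : Fin d, C * (2 ^ s * ρ ^ 2 * ∫ y, ‖F y‖ ^ 2)) := by
        gcongr with j _
        refine (h p z hp (fun i => (hz1 i).trans hu) _ (hmj j) (hwj j) t).trans ?_
        gcongr
        rw [← integral_const_mul]
        exact integral_mono (hwj j) (hF0.const_mul _) (hlej j)
    _ = _ := by
        simp only [Finset.sum_const, Finset.card_univ, Fintype.card_fin, nsmul_eq_mul]
        ring

/-- A Poincaré inequality at unit scale for functions `f = fourierAt F` that vanish on a relatively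
dense set `X`. The samples of `f` on translates of a separated subset of `X` are increments of `f`
from its zeros. Low frequencies contribute little to them, by the mean value inequality, and can be
absorbed; high frequencies are controlled by the right-hand side. -/
theorem exists_poincare_unit {d s : ℕ} (hs : d < 2 * s) :
    ∃ A : ℝ, 0 < A ∧ ∀ X : Set (Rd d), X.Countable → (∀ x, ∃ p ∈ X, dist x p ≤ 1) →
      ∀ F : Rd d → ℂ, AEStronglyMeasurable F volume →
        (Integrable fun y => (1 + ‖y‖ ^ 2) ^ s * ‖F y‖ ^ 2) →
        (∀ p ∈ X, fourierAt F p = 0) →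
        ∫ y, ‖F y‖ ^ 2 ≤ A * ∫ y, ‖y‖ ^ (2 * s) * ‖F y‖ ^ 2 := by
  obtain ⟨C₁, hC₁, hlow⟩ := exists_sum_low_frequency_le hs
  obtain ⟨C₂, hC₂, hhigh⟩ := exists_sum_norm_fourierAt_sq_le hs one_pos (zero_le_two (α := ℝ))
  set V : ℝ := volume.real (Metric.closedBall (0 : Rd d) 2) with hV
  have hV0 : 0 ≤ V := measureReal_nonneg
  -- the cut-off frequency makes the low part at most half of the total
  set ρ : ℝ := (1 + 4 * V * C₁)⁻¹ with hρ
  have hden : 1 ≤ 1 + 4 * V * C₁ := by nlinarith [mul_nonneg hV0 hC₁]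
  have hρ0 : 0 < ρ := by positivity
  have hρ1 : ρ ≤ 1 := inv_le_one_of_one_le₀ hden
  have hρV : V * (2 * (C₁ * ρ ^ 2)) ≤ 1 / 2 := by
    have h1 : ρ * (1 + 4 * V * C₁) = 1 := inv_mul_cancel₀ (by positivity)
    have h2 : ρ ^ 2 ≤ ρ := by nlinarith
    nlinarith [mul_nonneg hV0 hC₁]
  set B : ℝ := (1 + (ρ ^ 2)⁻¹) ^ s with hB
  refine ⟨16 * V * C₂ * B + 1, by positivity, fun X hXc hX F hF hF2 hzero => ?_⟩
  obtain ⟨P, hPX, hPsep, hPd⟩ := exists_separated_subset hX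
  have hF0 := integrable_norm_sq hF hF2
  have hFs := integrable_norm_pow_mul hF hF2
  set I₀ : ℝ := ∫ y, ‖F y‖ ^ 2 with hI₀
  set I₁ : ℝ := ∫ y, ‖y‖ ^ (2 * s) * ‖F y‖ ^ 2 with hI₁
  have hI₀0 : 0 ≤ I₀ := integral_nonneg fun y => by positivity
  have hI₁0 : 0 ≤ I₁ := integral_nonneg fun y => by positivity
  have hms : MeasurableSet {y : Rd d | ‖y‖ ≤ ρ} := measurableSet_le measurable_norm measurable_const
  set Fl : Rd d → ℂ := Set.indicator {y | ‖y‖ ≤ ρ} F with hFl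
  set Fh : Rd d → ℂ := Set.indicator {y | ‖y‖ ≤ ρ}ᶜ F with hFh
  have hFlm : AEStronglyMeasurable Fl volume := hF.indicator hms
  have hFhm : AEStronglyMeasurable Fh volume := hF.indicator hms.compl
  have hlle : ∀ y, ‖Fl y‖ ≤ ‖F y‖ := fun y => norm_indicator_le_norm_self _ _
  have hhle : ∀ y, ‖Fh y‖ ≤ ‖F y‖ := fun y => norm_indicator_le_norm_self _ _
  have hFl0 : Integrable fun y => ‖Fl y‖ ^ 2 :=
    hF0.mono' (hFlm.norm.pow 2) (Filter.Eventually.of_forall fun y => by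
      rw [Real.norm_of_nonneg (by positivity)]
      have := hlle y
      gcongr)
  have hwl : Integrable fun y => (1 + ‖y‖ ^ 2) ^ s * ‖Fl y‖ ^ 2 :=
    hF2.mono' (AEStronglyMeasurable.mul (by fun_prop) (hFlm.norm.pow 2))
      (Filter.Eventually.of_forall fun y => by
        rw [Real.norm_of_nonneg (by positivity)]
        have := hlle y
        gcongr)
  have hwh : Integrable fun y => (1 + ‖y‖ ^ 2) ^ s * ‖Fh y‖ ^ 2 :=
    hF2.mono' (AEStronglyMeasurable.mul (by fun_prop) (hFhm.norm.pow 2))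
      (Filter.Eventually.of_forall fun y => by
        rw [Real.norm_of_nonneg (by positivity)]
        have := hhle y
        gcongr)
  have hFint := integrable_of_integrable_weight hs hF hF2
  have hsplit : ∀ x, fourierAt F x = fourierAt Fl x + fourierAt Fh x := by
    intro x
    rw [← fourierAt_add (integrable_of_integrable_weight hs hFlm hwl)
      (integrable_of_integrable_weight hs hFhm hwh)]
    congr 1
    funext y
    rw [hFl, hFh, Set.indicator_self_add_compl_apply]
  have hIl : ∫ y, ‖Fl y‖ ^ 2 ≤ I₀ := integral_mono hFl0 hF0 fun y => by
    have := hlle y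
    simp only
    gcongr
  have hIh : ∫ y, (1 + ‖y‖ ^ 2) ^ s * ‖Fh y‖ ^ 2 ≤ B * I₁ := by
    rw [hI₁, ← integral_const_mul]
    refine integral_mono hwh (hFs.const_mul _) fun y => ?_
    simp only
    by_cases hy : ‖y‖ ≤ ρ
    · have : Fh y = 0 := by simp [hFh, hy]
      rw [this]
      simp only [norm_zero, ne_eq, OfNat.ofNat_ne_zero, not_false_eq_true, zero_pow, mul_zero]
      positivity
    · have e : Fh y = F y := by simp [hFh, hy]
      push Not at hy
      rw [e, ← mul_assoc, pow_mul, hB, ← mul_pow]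
      gcongr
      have : 1 ≤ (ρ ^ 2)⁻¹ * ‖y‖ ^ 2 := by
        rw [← div_eq_inv_mul, one_le_div (by positivity)]
        gcongr
      linarith
  have hpsep : ∀ i j : P, i ≠ j → 1 ≤ dist (i : Rd d) (j : Rd d) := fun i j hij =>
    hPsep i i.2 j j.2 fun h => hij (Subtype.ext h)
  have hK : ∀ u ∈ Metric.closedBall (0 : Rd d) 2, ∀ t : Finset P,
      ∑ p ∈ t, ‖fourierAt F (p + u)‖ ^ 2 ≤ 2 * (C₁ * ρ ^ 2) * I₀ + 8 * C₂ * B * I₁ := by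
    intro u hu t
    have hu' : ‖u‖ ≤ 2 := by simpa using hu
    have hA := hlow (fun p : P => (p : Rd d)) hpsep Fl hFlm hFl0 ρ hρ0.le hρ1
      (fun y hy => by simp [hFl, not_le.2 hy]) u hu' t
    have hB1 := hhigh (fun p : P => (p : Rd d)) (fun p : P => (p : Rd d) + u) hpsep
      (fun p => by simpa using hu') Fh hFhm hwh t
    have hB2 := hhigh (fun p : P => (p : Rd d)) (fun p : P => (p : Rd d)) hpsep
      (fun p => by simp) Fh hFhm hwh t
    have hpt : ∀ p : P, ‖fourierAt F (p + u)‖ ^ 2 ≤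
        2 * ‖fourierAt Fl (p + u) - fourierAt Fl p‖ ^ 2 +
          (4 * ‖fourierAt Fh (p + u)‖ ^ 2 + 4 * ‖fourierAt Fh p‖ ^ 2) := by
      intro p
      have e : fourierAt F (p + u) = (fourierAt Fl (p + u) - fourierAt Fl p) +
          fourierAt Fh (p + u) - fourierAt Fh p := by
        have h0 := hzero p (hPX p.2)
        rw [hsplit] at h0
        rw [hsplit (p + u)]
        linear_combination h0
      have h1 : ‖fourierAt F (p + u)‖ ≤ ‖fourierAt Fl (p + u) - fourierAt Fl p‖ +
          ‖fourierAt Fh (p + u)‖ + ‖fourierAt Fh p‖ := by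
        rw [e]
        exact (norm_sub_le _ _).trans (by gcongr; exact norm_add_le _ _)
      have h2 := pow_le_pow_left₀ (norm_nonneg _) h1 2
      nlinarith [sq_nonneg (‖fourierAt Fl (p + u) - fourierAt Fl p‖ -
        (‖fourierAt Fh (p + u)‖ + ‖fourierAt Fh p‖)),
        sq_nonneg (‖fourierAt Fh (p + u)‖ - ‖fourierAt Fh p‖)]
    have h3 := Finset.sum_le_sum (s := t) fun p _ => hpt p
    rw [Finset.sum_add_distrib, Finset.sum_add_distrib, ← Finset.mul_sum, ← Finset.mul_sum,
      ← Finset.mul_sum] at h3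
    have h4 : C₁ * ρ ^ 2 * ∫ y, ‖Fl y‖ ^ 2 ≤ C₁ * ρ ^ 2 * I₀ := by gcongr
    have h5 : C₂ * ∫ y, (1 + ‖y‖ ^ 2) ^ s * ‖Fh y‖ ^ 2 ≤ C₂ * (B * I₁) := by gcongr
    linarith
  have hfin := integral_norm_sq_le_of_sum_translates (continuous_fourierAt hFint)
    (hXc.mono hPX) hPd (by positivity) hK
  rw [integral_norm_sq_fourierAt hFint (memLp_of_integrable_weight hF hF2), ← hI₀, ← hV] at hfin
  have h6 : V * (2 * (C₁ * ρ ^ 2) * I₀ + 8 * C₂ * B * I₁) ≤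
      1 / 2 * I₀ + 8 * V * C₂ * B * I₁ := by
    have := mul_le_mul_of_nonneg_right hρV hI₀0
    nlinarith
  nlinarith

/-! ### The Poincaré inequality on dense sets -/

/-- Young's inequality `x^s ≤ (1 - s/k) + (s/k) x^k`, with denominators cleared. -/
theorem mul_pow_le_sub_add_mul_pow {s k : ℕ} (hs : 0 < s) (hsk : s ≤ k) {x : ℝ} (hx : 0 ≤ x) :
    (k : ℝ) * x ^ s ≤ (k - s) + s * x ^ k := by
  have hk : (0:ℝ) < k := by exact_mod_cast hs.trans_le hsk
  have hsk' : (s : ℝ) ≤ k := by exact_mod_cast hsk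
  have h := Real.geom_mean_le_arith_mean2_weighted (w₁ := (k - s) / k) (w₂ := s / k) (p₁ := 1)
    (p₂ := x ^ k) (div_nonneg (by linarith) hk.le) (by positivity) zero_le_one (by positivity)
    (by field_simp; ring)
  rw [Real.one_rpow, one_mul, ← Real.rpow_natCast, ← Real.rpow_mul hx,
    mul_div_cancel₀ _ hk.ne', Real.rpow_natCast, Real.rpow_natCast] at h
  have := mul_le_mul_of_nonneg_left h hk.le
  refine this.trans (le_of_eq ?_)
  field_simp

theorem fourierAt_comp_inv_smul {d : ℕ} {lam : ℝ} (hlam : 0 < lam) (F : Rd d → ℂ) (x : Rd d) :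
    fourierAt (fun y => F (lam⁻¹ • y)) x = (lam ^ d : ℝ) * fourierAt F (lam • x) := by
  unfold fourierAt
  have h := Measure.integral_comp_smul (volume : Measure (Rd d))
    (fun z => F z * Complex.exp (-Complex.I * ((inner ℝ z (lam • x) : ℝ) : ℂ))) lam⁻¹
  rw [finrank_euclideanSpace, Fintype.card_fin, inv_pow, inv_inv, abs_of_pos (by positivity),
    Complex.real_smul] at h
  rw [mul_left_comm, ← h]
  congr 1
  refine integral_congr_ae (Filter.Eventually.of_forall fun y => ?_)
  simp only
  rw [inner_smul_left, inner_smul_right, conj_trivial, inv_mul_cancel_left₀ hlam.ne']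

theorem integral_comp_inv_smul {d : ℕ} {lam : ℝ} (hlam : 0 < lam) (f : Rd d → ℝ) :
    ∫ y, f (lam⁻¹ • y) = lam ^ d * ∫ y, f y := by
  rw [Measure.integral_comp_smul, finrank_euclideanSpace, Fintype.card_fin, inv_pow, inv_inv,
    abs_of_pos (by positivity), smul_eq_mul]

/-- Functions of Sobolev order `k ≥ s > d/2` that vanish on a `lam`-dense set obey a Poincaré
inequality of order `k` whose constant is the `2k`-th power of a multiple of `lam`. The case
`k = s` follows by dilation from the unit scale, and interpolation then gives all `k ≥ s`. -/
theorem exists_poincare {d s : ℕ} (hs : d < 2 * s) :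
    ∃ A : ℝ, 0 < A ∧ ∀ lam : ℝ, 0 < lam → ∀ X : Set (Rd d), X.Countable →
      (∀ x, ∃ p ∈ X, dist x p ≤ lam) → ∀ k : ℕ, s ≤ k →
      ∀ F : Rd d → ℂ, AEStronglyMeasurable F volume →
        (Integrable fun y => (1 + ‖y‖ ^ 2) ^ k * ‖F y‖ ^ 2) →
        (∀ p ∈ X, fourierAt F p = 0) →
        ∫ y, ‖F y‖ ^ 2 ≤ (A * lam) ^ (2 * k) * ∫ y, ‖y‖ ^ (2 * k) * ‖F y‖ ^ 2 := by
  obtain ⟨A₁, hA₁, h⟩ := exists_poincare_unit hs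
  have hs0 : 0 < s := by omega
  have hs0' : (0:ℝ) < s := by exact_mod_cast hs0
  set A : ℝ := A₁ ^ ((2 * s : ℝ)⁻¹) with hA
  have hApow : A ^ (2 * s) = A₁ := by
    rw [hA, ← Real.rpow_natCast, ← Real.rpow_mul hA₁.le]
    push_cast
    rw [inv_mul_cancel₀ (by positivity), Real.rpow_one]
  refine ⟨A, by positivity, fun lam hlam X hXc hX k hsk F hF hF2 hzero => ?_⟩
  have hF0 := integrable_norm_sq hF hF2
  have hFk := integrable_norm_pow_mul hF hF2
  have hF2s : Integrable fun y => (1 + ‖y‖ ^ 2) ^ s * ‖F y‖ ^ 2 :=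
    hF2.mono' (AEStronglyMeasurable.mul (by fun_prop) (hF.norm.pow 2))
      (Filter.Eventually.of_forall fun y => by
        rw [Real.norm_of_nonneg (by positivity)]
        refine mul_le_mul_of_nonneg_right (pow_le_pow_right₀ ?_ hsk) (by positivity)
        nlinarith [sq_nonneg ‖y‖])
  have hFs := integrable_norm_pow_mul hF hF2s
  have hqmp := quasiMeasurePreserving_smul (d := d) (inv_ne_zero hlam.ne')
  have hnorm : ∀ y : Rd d, ‖lam⁻¹ • y‖ = lam⁻¹ * ‖y‖ := fun y => by
    rw [norm_smul, Real.norm_of_nonneg (by positivity)]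
  have hunit := h {x | lam • x ∈ X}
    (hXc.preimage (f := fun x : Rd d => lam • x) (smul_right_injective _ hlam.ne')) (fun x => by
      obtain ⟨p, hp, hxp⟩ := hX (lam • x)
      refine ⟨lam⁻¹ • p, by simpa [smul_smul, hlam.ne'] using hp, ?_⟩
      have e : x = lam⁻¹ • lam • x := by rw [smul_smul, inv_mul_cancel₀ hlam.ne', one_smul]
      rw [e, dist_smul₀, Real.norm_of_nonneg (by positivity), inv_mul_le_iff₀ hlam, mul_one]
      exact hxp)
    (fun y => F (lam⁻¹ • y)) (hF.comp_quasiMeasurePreserving hqmp) (by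
      have hG : Integrable fun z => (1 + lam ^ 2 * ‖z‖ ^ 2) ^ s * ‖F z‖ ^ 2 := by
        refine (hF2s.const_mul ((1 + lam ^ 2) ^ s)).mono'
          (AEStronglyMeasurable.mul (by fun_prop) (hF.norm.pow 2))
          (Filter.Eventually.of_forall fun y => ?_)
        rw [Real.norm_of_nonneg (by positivity), ← mul_assoc, ← mul_pow (1 + lam ^ 2)]
        refine mul_le_mul_of_nonneg_right (pow_le_pow_left₀ (by positivity) ?_ s) (by positivity)
        nlinarith [sq_nonneg lam, sq_nonneg ‖y‖]
      refine (hG.comp_smul (inv_ne_zero hlam.ne')).congr (Filter.Eventually.of_forall fun y => ?_)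
      simp only
      rw [hnorm, mul_pow, ← mul_assoc, ← mul_pow, mul_inv_cancel₀ hlam.ne', one_pow, one_mul])
    (fun p hp => by
      rw [fourierAt_comp_inv_smul hlam, hzero _ hp, mul_zero])
  have e1 := integral_comp_inv_smul hlam fun y => ‖F y‖ ^ 2
  have e2 : ∫ y, ‖y‖ ^ (2 * s) * ‖F (lam⁻¹ • y)‖ ^ 2 =
      lam ^ d * (lam ^ (2 * s) * ∫ y, ‖y‖ ^ (2 * s) * ‖F y‖ ^ 2) := by
    rw [← integral_const_mul, ← integral_comp_inv_smul hlam]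
    refine integral_congr_ae (Filter.Eventually.of_forall fun y => ?_)
    simp only
    rw [hnorm, ← mul_assoc, ← mul_pow, mul_inv_cancel_left₀ hlam.ne']
  rw [e1, e2, mul_left_comm] at hunit
  have hbase := le_of_mul_le_mul_left hunit (by positivity : 0 < lam ^ d)
  rw [← mul_assoc, ← hApow, ← mul_pow] at hbase
  set τ : ℝ := A * lam with hτ
  have hpt : ∀ y : Rd d, (k : ℝ) * (τ ^ (2 * s) * (‖y‖ ^ (2 * s) * ‖F y‖ ^ 2)) ≤
      (k - s) * ‖F y‖ ^ 2 + s * τ ^ (2 * k) * (‖y‖ ^ (2 * k) * ‖F y‖ ^ 2) := by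
    intro y
    have := mul_pow_le_sub_add_mul_pow hs0 hsk (x := (τ * ‖y‖) ^ 2) (by positivity)
    rw [← pow_mul, ← pow_mul, mul_pow τ, mul_pow τ] at this
    have := mul_le_mul_of_nonneg_right this (sq_nonneg ‖F y‖)
    linarith
  have hint := integral_mono ((hFs.const_mul (τ ^ (2 * s))).const_mul (k : ℝ))
    ((hF0.const_mul ((k : ℝ) - s)).add (hFk.const_mul (s * τ ^ (2 * k)))) hpt
  rw [integral_const_mul] at hint
  simp only [Pi.add_apply] at hint
  rw [integral_const_mul, integral_add (hF0.const_mul _) (hFk.const_mul _), integral_const_mul,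
    integral_const_mul] at hint
  have hk0 : (0:ℝ) ≤ k := by positivity
  have h3 := mul_le_mul_of_nonneg_left hbase hk0
  refine le_of_mul_le_mul_left ?_ hs0'
  linarith

/-- A knot set of mesh `lam` is `lam`-dense. -/
theorem IsKnotSet.exists_dist_le {d : ℕ} {X : Set (Rd d)} {lam : ℝ} (h : IsKnotSet X lam)
    (x : Rd d) : ∃ p ∈ X, dist x p ≤ lam := by
  obtain ⟨Q, -, hQX, -, hdiam, -, hcov⟩ := h.cells
  have hx : x ∈ ⋃ p ∈ X, closure (Q p) := by rw [hcov]; trivial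
  simp only [Set.mem_iUnion] at hx
  obtain ⟨p, hp, hxp⟩ := hx
  have hpQ : p ∈ Q p := by
    have : p ∈ Q p ∩ X := by rw [hQX p hp]; rfl
    exact this.1
  refine ⟨p, hp, ?_⟩
  have hcl : closure (Q p) ⊆ {z | dist z p ≤ lam} :=
    closure_minimal (fun z hz => hdiam p hp z hz p hpQ)
      (isClosed_le (continuous_id.dist continuous_const) continuous_const)
  exact hcl hxp

/-! ### Densities and the energy form -/

/-- Multiplication by a bounded continuous real function, as an operator on `L²`. -/
theorem exists_mulOp {d : ℕ} {m : Rd d → ℝ} (hm : Continuous m) {C : ℝ} (hC : ∀ y, |m y| ≤ C) :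
    ∃ M : Lp ℂ 2 (volume : Measure (Rd d)) →L[ℂ] Lp ℂ 2 (volume : Measure (Rd d)),
      ∀ g, M g =ᵐ[volume] fun y => (m y : ℂ) * g y := by
  have hmem : MemLp (fun y => (m y : ℂ)) ⊤ (volume : Measure (Rd d)) :=
    memLp_top_of_bound (Complex.continuous_ofReal.comp hm).aestronglyMeasurable C
      (Filter.Eventually.of_forall fun y => by
        rw [Complex.norm_real]; exact hC y)
  have hcoe : ∀ g : Lp ℂ 2 (volume : Measure (Rd d)),
      (hmem.toLp _ • g : Lp ℂ 2 (volume : Measure (Rd d))) =ᵐ[volume]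
        fun y => (m y : ℂ) * g y := by
    intro g
    filter_upwards [Lp.coeFn_lpSMul (r := 2) (hmem.toLp _) g, hmem.coeFn_toLp] with y h1 h2
    rw [h1, Pi.smul_apply', h2, smul_eq_mul]
  let M₀ : Lp ℂ 2 (volume : Measure (Rd d)) →ₗ[ℂ] Lp ℂ 2 (volume : Measure (Rd d)) :=
    { toFun := fun g => hmem.toLp _ • g
      map_add' := fun g h => by
        refine Lp.ext ?_
        filter_upwards [hcoe g, hcoe h, hcoe (g + h), Lp.coeFn_add g h,
          Lp.coeFn_add (hmem.toLp _ • g : Lp ℂ 2 (volume : Measure (Rd d)))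
            (hmem.toLp _ • h)] with y h1 h2 h3 h4 h5
        rw [h3, h5, Pi.add_apply, h1, h2, h4, Pi.add_apply, mul_add]
      map_smul' := fun c g => by
        refine Lp.ext ?_
        filter_upwards [hcoe g, hcoe (c • g), Lp.coeFn_smul c g,
          Lp.coeFn_smul c (hmem.toLp _ • g : Lp ℂ 2 (volume : Measure (Rd d)))]
          with y h1 h2 h3 h4
        rw [h2, RingHom.id_apply, h4, Pi.smul_apply, h1, h3, Pi.smul_apply, smul_eq_mul,
          smul_eq_mul, mul_left_comm] }
  exact ⟨M₀.mkContinuous ‖hmem.toLp _‖ fun g => Lp.norm_smul_le _ _, hcoe⟩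

theorem abs_inv_bracket_pow_le {d : ℕ} (k : ℕ) (y : Rd d) : |(bracket y ^ k)⁻¹| ≤ 1 := by
  rw [abs_of_pos (by have := bracket_pos y; positivity)]
  exact inv_le_one_of_one_le₀ (one_le_pow₀ (one_le_bracket y))

/-- Multiplication by `⟨y⟩^{-k}`; it maps `⟨y⟩^k F` to the density `F`. -/
noncomputable def densityOp (d k : ℕ) :
    Lp ℂ 2 (volume : Measure (Rd d)) →L[ℂ] Lp ℂ 2 (volume : Measure (Rd d)) :=
  (exists_mulOp (continuous_inv_bracket_pow k) (abs_inv_bracket_pow_le k)).choose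

theorem coeFn_densityOp {d : ℕ} (k : ℕ) (g : Lp ℂ 2 (volume : Measure (Rd d))) :
    densityOp d k g =ᵐ[volume] fun y => (((bracket y ^ k)⁻¹ : ℝ) : ℂ) * g y :=
  (exists_mulOp (continuous_inv_bracket_pow k) (abs_inv_bracket_pow_le k)).choose_spec g

/-- The function `(‖y‖² + ε)^{k/2} ⟨y⟩^{-k}`. -/
noncomputable def formFun {d : ℕ} (ε : ℝ) (k : ℕ) (y : Rd d) : ℝ :=
  (√(‖y‖ ^ 2 + ε) * (bracket y)⁻¹) ^ k

theorem continuous_formFun {d : ℕ} (ε : ℝ) (k : ℕ) :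
    Continuous (formFun ε k : Rd d → ℝ) := by
  have : Continuous fun y : Rd d => (bracket y)⁻¹ :=
    continuous_bracket.inv₀ fun y => (bracket_pos y).ne'
  unfold formFun
  fun_prop

theorem formFun_sq {d : ℕ} {ε : ℝ} (hε : 0 ≤ ε) (k : ℕ) (y : Rd d) :
    formFun ε k y ^ 2 = (‖y‖ ^ 2 + ε) ^ k * ((bracket y ^ k)⁻¹) ^ 2 := by
  rw [formFun, ← pow_mul, mul_comm k 2, pow_mul, mul_pow, Real.sq_sqrt (by positivity), mul_pow,
    ← inv_pow, ← pow_mul, ← pow_mul, mul_comm 2 k]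

theorem abs_formFun_le {d : ℕ} {ε : ℝ} (hε : 0 ≤ ε) (k : ℕ) (y : Rd d) :
    |formFun ε k y| ≤ √(1 + ε) ^ k := by
  have hb := bracket_pos y
  rw [abs_of_nonneg (by unfold formFun; positivity)]
  unfold formFun
  gcongr
  rw [← div_eq_mul_inv, div_le_iff₀ hb, bracket, ← Real.sqrt_mul (by positivity)]
  apply Real.sqrt_le_sqrt
  nlinarith [mul_nonneg hε (sq_nonneg ‖y‖), sq_nonneg ‖y‖]

/-- Multiplication by `formFun ε k`. For `g = ⟨y⟩^k F` the square of its norm at `g` is the energy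
`∫ (‖y‖² + ε)^k |F|²` of the spline problem. -/
noncomputable def formOp (d : ℕ) {ε : ℝ} (hε : 0 ≤ ε) (k : ℕ) :
    Lp ℂ 2 (volume : Measure (Rd d)) →L[ℂ] Lp ℂ 2 (volume : Measure (Rd d)) :=
  (exists_mulOp (continuous_formFun ε k) (abs_formFun_le hε k)).choose

theorem coeFn_formOp {d : ℕ} {ε : ℝ} (hε : 0 ≤ ε) (k : ℕ)
    (g : Lp ℂ 2 (volume : Measure (Rd d))) :
    formOp d hε k g =ᵐ[volume] fun y => (formFun ε k y : ℂ) * g y :=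
  (exists_mulOp (continuous_formFun ε k) (abs_formFun_le hε k)).choose_spec g

theorem inner_formOp_formOp {d : ℕ} {ε : ℝ} (hε : 0 ≤ ε) (k : ℕ)
    (g h : Lp ℂ 2 (volume : Measure (Rd d))) :
    inner ℂ (formOp d hε k g) (formOp d hε k h) =
      ∫ y, (starRingEnd ℂ) (g y) * (((formFun ε k y) ^ 2 : ℝ) : ℂ) * h y := by
  rw [L2.inner_def]
  refine integral_congr_ae ?_
  filter_upwards [coeFn_formOp hε k g, coeFn_formOp hε k h] with y h1 h2
  rw [h1, h2, RCLike.inner_apply, map_mul, Complex.conj_ofReal]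
  push_cast
  ring

theorem weight_mul_norm_densityOp_sq {d : ℕ} (k : ℕ) (g : Lp ℂ 2 (volume : Measure (Rd d))) :
    (fun y => (1 + ‖y‖ ^ 2) ^ k * ‖densityOp d k g y‖ ^ 2) =ᵐ[volume] fun y => ‖g y‖ ^ 2 := by
  filter_upwards [coeFn_densityOp k g] with y hy
  have hb := pow_pos (bracket_pos y) k
  rw [hy, norm_mul, mul_pow, Complex.norm_real, Real.norm_eq_abs, sq_abs, ← bracket_pow_sq,
    ← mul_assoc, ← mul_pow, mul_inv_cancel₀ hb.ne', one_pow, one_mul]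

theorem integrable_weight_densityOp {d : ℕ} (k : ℕ) (g : Lp ℂ 2 (volume : Measure (Rd d))) :
    Integrable fun y => (1 + ‖y‖ ^ 2) ^ k * ‖densityOp d k g y‖ ^ 2 :=
  ((memLp_two_iff_integrable_sq_norm (Lp.aestronglyMeasurable g)).1 (Lp.memLp g)).congr
    (weight_mul_norm_densityOp_sq k g).symm

theorem integrable_densityOp {d k : ℕ} (hk : d < 2 * k) (g : Lp ℂ 2 (volume : Measure (Rd d))) :
    Integrable (densityOp d k g) :=
  integrable_of_integrable_weight hk (Lp.aestronglyMeasurable _) (integrable_weight_densityOp k g)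

theorem fourierAt_congr_ae {d : ℕ} {F G : Rd d → ℂ} (h : F =ᵐ[volume] G) :
    fourierAt F = fourierAt G := by
  funext x
  unfold fourierAt
  congr 1
  refine integral_congr_ae ?_
  filter_upwards [h] with y hy
  rw [hy]

theorem inner_evalVec_eq_fourierAt_densityOp {d k : ℕ} (hk : d < 2 * k) (x : Rd d)
    (g : Lp ℂ 2 (volume : Measure (Rd d))) :
    inner ℂ (evalVec hk x) g = fourierAt (densityOp d k g) x := by
  rw [inner_evalVec, fourierAt_congr_ae (coeFn_densityOp k g)]

theorem norm_formOp_sq {d : ℕ} {ε : ℝ} (hε : 0 ≤ ε) (k : ℕ)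
    (g : Lp ℂ 2 (volume : Measure (Rd d))) :
    (fun y => ‖formOp d hε k g y‖ ^ 2) =ᵐ[volume]
      fun y => (‖y‖ ^ 2 + ε) ^ k * ‖densityOp d k g y‖ ^ 2 := by
  filter_upwards [coeFn_formOp hε k g, coeFn_densityOp k g] with y h1 h2
  rw [h1, h2, norm_mul, norm_mul, mul_pow, mul_pow, Complex.norm_real, Complex.norm_real,
    Real.norm_eq_abs, Real.norm_eq_abs, sq_abs, sq_abs, formFun_sq hε, mul_assoc]

theorem integral_le_norm_formOp_sq {d : ℕ} {ε : ℝ} (hε : 0 ≤ ε) (k : ℕ)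
    (g : Lp ℂ 2 (volume : Measure (Rd d))) :
    ∫ y, ‖y‖ ^ (2 * k) * ‖densityOp d k g y‖ ^ 2 ≤ ‖formOp d hε k g‖ ^ 2 := by
  rw [norm_sq_eq_integral]
  refine integral_mono_ae (integrable_norm_pow_mul (Lp.aestronglyMeasurable _)
    (integrable_weight_densityOp k g)) ((memLp_two_iff_integrable_sq_norm
      (Lp.aestronglyMeasurable _)).1 (Lp.memLp _)) ?_
  filter_upwards [norm_formOp_sq hε k g] with y hy
  rw [hy, pow_mul]
  gcongr
  linarith

theorem one_add_pow_le_two_pow_mul {a : ℝ} (ha : 0 ≤ a) (k : ℕ) :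
    (1 + a) ^ k ≤ 2 ^ k * (1 + a ^ k) := by
  have h := add_pow_le zero_le_one ha k
  rw [one_pow] at h
  refine h.trans ?_
  gcongr
  · exact one_le_two
  · exact Nat.sub_le k 1

/-- The energy is coercive on a space where a Poincaré inequality holds. -/
theorem norm_sq_le_of_poincare {d : ℕ} {ε : ℝ} (hε : 0 ≤ ε) (k : ℕ)
    (g : Lp ℂ 2 (volume : Measure (Rd d))) {B : ℝ}
    (h : ‖densityOp d k g‖ ^ 2 ≤ B * ‖formOp d hε k g‖ ^ 2) :
    ‖g‖ ^ 2 ≤ 2 ^ k * (B + 1) * ‖formOp d hε k g‖ ^ 2 := by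
  have hw := integrable_weight_densityOp k g
  have hm := Lp.aestronglyMeasurable (densityOp d k g)
  have h0 := integrable_norm_sq hm hw
  have hk := integrable_norm_pow_mul hm hw
  have e1 : ‖g‖ ^ 2 = ∫ y, (1 + ‖y‖ ^ 2) ^ k * ‖densityOp d k g y‖ ^ 2 := by
    rw [norm_sq_eq_integral]
    exact integral_congr_ae (weight_mul_norm_densityOp_sq k g).symm
  have e2 : ∫ y, (1 + ‖y‖ ^ 2) ^ k * ‖densityOp d k g y‖ ^ 2 ≤
      ∫ y, 2 ^ k * (‖densityOp d k g y‖ ^ 2 + ‖y‖ ^ (2 * k) * ‖densityOp d k g y‖ ^ 2) := by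
    refine integral_mono hw ((h0.add hk).const_mul _) fun y => ?_
    simp only
    rw [pow_mul]
    have hle := one_add_pow_le_two_pow_mul (sq_nonneg ‖y‖) k
    calc _ ≤ (2 ^ k * (1 + (‖y‖ ^ 2) ^ k)) * ‖densityOp d k g y‖ ^ 2 := by gcongr
      _ = _ := by ring
  rw [integral_const_mul, integral_add h0 hk, ← norm_sq_eq_integral] at e2
  rw [e1]
  refine e2.trans ?_
  rw [mul_assoc]
  gcongr
  have := integral_le_norm_formOp_sq hε k g
  linarith

/-! ### Fourier transforms of Schwartz functions -/

/-- The Fourier transform maps the Schwartz space onto itself. -/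
theorem exists_fourierAt_eq {d : ℕ} (χ : 𝓢(Rd d, ℂ)) : ∃ β : 𝓢(Rd d, ℂ), fourierAt β = χ := by
  let e : Rd d ≃L[ℝ] Rd d :=
    ContinuousLinearEquiv.smulLeft (Units.mk0 (2 * Real.pi)⁻¹ (inv_ne_zero Real.two_pi_pos.ne'))
  refine ⟨(((2 * Real.pi) ^ (-(d : ℝ) / 2) : ℝ) : ℂ) •
    SchwartzMap.compCLMOfContinuousLinearEquiv ℂ e (𝓕⁻ χ), ?_⟩
  funext x
  rw [fourierAt_eq_fourier]
  have : (fun z => (((2 * Real.pi) ^ ((d : ℝ) / 2) : ℝ) : ℂ) *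
      ((((2 * Real.pi) ^ (-(d : ℝ) / 2) : ℝ) : ℂ) •
      SchwartzMap.compCLMOfContinuousLinearEquiv ℂ e (𝓕⁻ χ)) ((2 * Real.pi) • z)) =
      (𝓕⁻ χ : 𝓢(Rd d, ℂ)) := by
    funext z
    have he : e ((2 * Real.pi) • z) = z := by
      change (2 * Real.pi)⁻¹ • (2 * Real.pi) • z = z
      rw [smul_smul, inv_mul_cancel₀ Real.two_pi_pos.ne', one_smul]
    rw [smul_apply, SchwartzMap.compCLMOfContinuousLinearEquiv_apply, Function.comp_apply, he,
      smul_eq_mul, ← mul_assoc, ← Complex.ofReal_mul, ← Real.rpow_add Real.two_pi_pos]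
    ring_nf
    simp
  rw [this, ← SchwartzMap.fourier_coe, FourierTransform.fourier_fourierInv_eq]

theorem exists_schwartz_eq_fourierAt {d : ℕ} (W : 𝓢(Rd d, ℂ)) :
    ∃ β : 𝓢(Rd d, ℂ), (β : Rd d → ℂ) = fourierAt W := by
  let e : Rd d ≃L[ℝ] Rd d :=
    ContinuousLinearEquiv.smulLeft (Units.mk0 (2 * Real.pi)⁻¹ (inv_ne_zero Real.two_pi_pos.ne'))
  refine ⟨(((2 * Real.pi) ^ (-(d : ℝ) / 2) : ℝ) : ℂ) •
    SchwartzMap.compCLMOfContinuousLinearEquiv ℂ e (𝓕 W), ?_⟩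
  funext x
  rw [fourierAt_eq]
  rfl

theorem exists_norm_fourierAt_schwartz_le {d : ℕ} (W : 𝓢(Rd d, ℂ)) (N : ℕ) :
    ∃ C : ℝ, 0 ≤ C ∧ ∀ x, ‖fourierAt W x‖ ≤ C * ((1 + ‖x‖ ^ 2) ^ N)⁻¹ := by
  obtain ⟨β, hβ⟩ := exists_schwartz_eq_fourierAt W
  rw [← hβ]
  obtain ⟨C₀, -, h0⟩ := β.decay 0 0
  obtain ⟨C₁, -, h1⟩ := β.decay (2 * N) 0
  simp only [pow_zero, one_mul, norm_iteratedFDeriv_zero] at h0 h1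
  have hC0 : 0 ≤ C₀ := (norm_nonneg _).trans (h0 0)
  have hC1 : 0 ≤ C₁ := le_trans (by positivity) (h1 0)
  refine ⟨2 ^ N * (C₀ + C₁), by positivity, fun x => ?_⟩
  rw [← div_eq_mul_inv, le_div_iff₀ (by positivity)]
  have hle : (1 + ‖x‖ ^ 2) ^ N ≤ 2 ^ N * (1 + ‖x‖ ^ (2 * N)) := by
    rw [pow_mul]
    exact one_add_pow_le_two_pow_mul (sq_nonneg ‖x‖) N
  calc ‖β x‖ * (1 + ‖x‖ ^ 2) ^ N ≤ ‖β x‖ * (2 ^ N * (1 + ‖x‖ ^ (2 * N))) := by gcongr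
    _ = 2 ^ N * (‖β x‖ + ‖x‖ ^ (2 * N) * ‖β x‖) := by ring
    _ ≤ _ := by gcongr; exacts [h0 x, h1 x]

/-! ### Interpolation by bumps and the spline operator -/

theorem fourierAt_mul_exp_inner {d : ℕ} (F : Rd d → ℂ) (p x : Rd d) :
    fourierAt (fun y => F y * Complex.exp (Complex.I * ((inner ℝ p y : ℝ) : ℂ))) x =
      fourierAt F (x - p) := by
  unfold fourierAt
  congr 1
  refine integral_congr_ae (Filter.Eventually.of_forall fun y => ?_)
  simp only
  rw [mul_assoc, ← Complex.exp_add, inner_sub_right, real_inner_comm y p]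
  congr 2
  push_cast
  ring

theorem exists_schwartz_weight_mul_norm_sq {d : ℕ} (k : ℕ) (β : 𝓢(Rd d, ℂ)) :
    ∃ W : 𝓢(Rd d, ℂ), ∀ y, W y = (((1 + ‖y‖ ^ 2) ^ k : ℝ) : ℂ) *
      ((starRingEnd ℂ) (β y) * β y) := by
  let βc : 𝓢(Rd d, ℂ) := SchwartzMap.postcompCLM (𝕜 := ℝ) (Complex.conjCLE : ℂ →L[ℝ] ℂ) β
  refine ⟨SchwartzMap.smulLeftCLM ℂ (fun y : Rd d => (1 + ‖y‖ ^ 2) ^ k)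
    (SchwartzMap.pairing (ContinuousLinearMap.mul ℂ ℂ) βc β), fun y => ?_⟩
  rw [SchwartzMap.smulLeftCLM_apply_apply (by fun_prop), SchwartzMap.pairing_apply_apply,
    Complex.real_smul]
  rfl

/-- A family biorthogonal to the evaluation vectors at uniformly discrete points, built from
translates of a bump function, that passes Schur's test. -/
theorem exists_biorthogonal_family {d k : ℕ} (hk : d < 2 * k) {ι : Type} (p : ι → Rd d) {δ : ℝ}
    (hδ : 0 < δ) (hp : ∀ i j, i ≠ j → δ ≤ dist (p i) (p j)) :
    ∃ b : ι → Lp ℂ 2 (volume : Measure (Rd d)),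
      (∀ i, inner ℂ (evalVec hk (p i)) (b i) = 1) ∧
      (∀ i j, i ≠ j → inner ℂ (evalVec hk (p i)) (b j) = 0) ∧
      ∃ C : ℝ, 0 ≤ C ∧ ∀ (s : Finset ι) (i : ι), ∑ j ∈ s, ‖inner ℂ (b i) (b j)‖ ≤ C := by
  let χ₀ : ContDiffBump (0 : Rd d) := ⟨δ / 4, δ / 2, by positivity, by linarith⟩
  have hχs : HasCompactSupport fun x => (χ₀ x : ℂ) :=
    χ₀.hasCompactSupport.comp_left Complex.ofReal_zero
  have hχd : ContDiff ℝ ∞ fun x => (χ₀ x : ℂ) := Complex.ofRealCLM.contDiff.comp χ₀.contDiff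
  obtain ⟨β, hβ⟩ := exists_fourierAt_eq (hχs.toSchwartzMap hχd)
  have hβ' : ∀ x, fourierAt β x = (χ₀ x : ℂ) := fun x => by rw [hβ]; rfl
  obtain ⟨W, hW⟩ := exists_schwartz_weight_mul_norm_sq k β
  set F : ι → Rd d → ℂ := fun i y =>
    β y * Complex.exp (Complex.I * ((inner ℝ (p i) y : ℝ) : ℂ)) with hF
  have hFc : ∀ i, Continuous (F i) := fun i => by
    have := β.continuous
    simp only [hF]
    fun_prop
  have hFw : ∀ i, Integrable fun y => (1 + ‖y‖ ^ 2) ^ k * ‖F i y‖ ^ 2 := by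
    intro i
    refine (W.integrable (μ := volume)).norm.congr (Filter.Eventually.of_forall fun y => ?_)
    simp only [hF]
    rw [hW, norm_mul, norm_mul, norm_mul, Complex.norm_exp_I_mul_ofReal, Complex.norm_real,
      RCLike.norm_conj, mul_one, Real.norm_of_nonneg (by positivity), sq ‖β y‖]
  have hmem := fun i => memLp_bracket_mul (hFc i).aestronglyMeasurable (hFw i)
  have hval : ∀ i j, inner ℂ (evalVec hk (p i)) ((hmem j).toLp _) =
      ((χ₀ (p i - p j) : ℝ) : ℂ) := by
    intro i j
    rw [inner_evalVec_toLp, fourierAt_mul_exp_inner, hβ']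
  refine ⟨fun i => (hmem i).toLp _, fun i => ?_, fun i j hij => ?_, ?_⟩
  · rw [hval, sub_self, χ₀.one_of_mem_closedBall (Metric.mem_closedBall_self (by positivity)),
      Complex.ofReal_one]
  · rw [hval, χ₀.zero_of_le_dist, Complex.ofReal_zero]
    rw [dist_zero_right, ← dist_eq_norm]
    have := hp i j hij
    change δ / 2 ≤ _
    linarith
  · obtain ⟨C₁, hC₁, h1⟩ := exists_norm_fourierAt_schwartz_le W k
    obtain ⟨C₂, hC₂, h2⟩ := exists_sum_inv_pow_le d k hk hδ le_rfl
    set κ : ℝ := (2 * Real.pi) ^ (-(d : ℝ) / 2) with hκ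
    have hκ0 : 0 < κ := by positivity
    refine ⟨κ⁻¹ * (C₁ * C₂), by positivity, fun s i => ?_⟩
    have hgram : ∀ j, inner ℂ ((hmem i).toLp _) ((hmem j).toLp _) =
        ((κ⁻¹ : ℝ) : ℂ) * fourierAt W (p i - p j) := by
      intro j
      rw [fourierAt, ← hκ, ← mul_assoc, ← Complex.ofReal_mul, inv_mul_cancel₀ hκ0.ne',
        Complex.ofReal_one, one_mul, L2.inner_def]
      refine integral_congr_ae ?_
      filter_upwards [(hmem i).coeFn_toLp, (hmem j).coeFn_toLp] with y hi hj
      rw [hi, hj, RCLike.inner_apply, hW, ← bracket_pow_sq]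
      simp only [hF, map_mul, Complex.conj_ofReal, ← Complex.exp_conj, Complex.conj_I]
      have e : Complex.exp (-Complex.I * ((inner ℝ y (p i - p j) : ℝ) : ℂ)) =
          Complex.exp (Complex.I * ((inner ℝ (p j) y : ℝ) : ℂ)) *
          Complex.exp (-Complex.I * ((inner ℝ (p i) y : ℝ) : ℂ)) := by
        rw [← Complex.exp_add, inner_sub_right, real_inner_comm y, real_inner_comm y]
        congr 1
        push_cast
        ring
      rw [e]
      push_cast
      ring
    calc ∑ j ∈ s, ‖inner ℂ ((hmem i).toLp _) ((hmem j).toLp _)‖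
        ≤ ∑ j ∈ s, κ⁻¹ * (C₁ * ((1 + ‖p j - p i‖ ^ 2) ^ k)⁻¹) := by
          refine Finset.sum_le_sum fun j _ => ?_
          rw [hgram, norm_mul, Complex.norm_real, Real.norm_of_nonneg (by positivity),
            norm_sub_rev (p j)]
          gcongr
          exact h1 _
      _ ≤ _ := by
          rw [← Finset.mul_sum, ← Finset.mul_sum]
          gcongr
          exact h2 p p hp (fun i => by simp) s _

/-- For uniformly discrete points, the synthesis operator of the evaluation vectors is bounded, and
its adjoint, the sampling operator, has a bounded right inverse. -/
theorem exists_sampling_system {d k : ℕ} (hk : d < 2 * k) {ι : Type} (p : ι → Rd d) {δ : ℝ}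
    (hδ : 0 < δ) (hp : ∀ i j, i ≠ j → δ ≤ dist (p i) (p j)) :
    ∃ R B : lp (fun _ : ι => ℂ) 2 →L[ℂ] Lp ℂ 2 (volume : Measure (Rd d)),
      (∀ a, HasSum (fun i => a i • evalVec hk (p i)) (R a)) ∧
      ∀ a, ContinuousLinearMap.adjoint R (B a) = a := by
  obtain ⟨C, hC, hs⟩ := exists_schur_evalVec hk hδ le_rfl
  obtain ⟨b, hb1, hb0, C', hC', hs'⟩ := exists_biorthogonal_family hk p hδ hp
  obtain ⟨R, hR⟩ := exists_synthesis hC (hs p p hp fun i => by simp)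
  obtain ⟨B, hB⟩ := exists_synthesis hC' hs'
  refine ⟨R, B, hR, fun a => ?_⟩
  ext i
  rw [adjoint_synthesis_apply hR]
  have h1 := (hB a).mapL (innerSL ℂ (evalVec hk (p i)))
  have h2 := hasSum_single (f := fun j => (innerSL ℂ (evalVec hk (p i))) (a j • b j)) i
    fun j hj => by simp [hb0 i j (Ne.symm hj)]
  refine (h1.unique h2).trans ?_
  simp [hb1]

/-- The spline interpolation operator of abstract data: a sampling operator `T = R†` with bounded
right inverse and an energy `‖q ·‖²` coercive on `ker T`. It sends `a` to the sample-interpolating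
vector whose energy is orthogonal to `ker T`; equivalently its image under the form is a
combination `R α` of the evaluation vectors. -/
theorem exists_spline_operator {H E : Type*} [NormedAddCommGroup H] [InnerProductSpace ℂ H]
    [CompleteSpace H] [NormedAddCommGroup E] [InnerProductSpace ℂ E] [CompleteSpace E]
    (R B : E →L[ℂ] H) (hRB : ∀ a, ContinuousLinearMap.adjoint R (B a) = a)
    (q : H →L[ℂ] H) {C : NNReal}
    (hC : ∀ n, ContinuousLinearMap.adjoint R n = 0 → ‖n‖ ≤ C * ‖q n‖) :
    ∃ S : E →L[ℂ] H, (∀ a, ContinuousLinearMap.adjoint R (S a) = a) ∧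
      (∀ a n, ContinuousLinearMap.adjoint R n = 0 → inner ℂ (q n) (q (S a)) = 0) ∧
      (∀ a, ∃ α : E, ∀ h, inner ℂ (q h) (q (S a)) = inner ℂ h (R α)) ∧
      ∀ g, (∃ α : E, ∀ h, inner ℂ (q h) (q g) = inner ℂ h (R α)) →
        g = S (ContinuousLinearMap.adjoint R g) := by
  obtain ⟨P, hP0, hP⟩ := exists_form_projection (ContinuousLinearMap.adjoint R) q hC
  have hS1 : ∀ a, ContinuousLinearMap.adjoint R ((B - P.comp B) a) = a := fun a => by
    simp [hRB, hP0]
  have hS2 : ∀ a n, ContinuousLinearMap.adjoint R n = 0 →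
      inner ℂ (q n) (q ((B - P.comp B) a)) = 0 := fun a n hn => by
    simp [hP _ n hn]
  refine ⟨B - P.comp B, hS1, hS2, fun a => ?_, fun g hg => ?_⟩
  · refine ⟨ContinuousLinearMap.adjoint B (ContinuousLinearMap.adjoint q
      (q ((B - P.comp B) a))), fun h => ?_⟩
    have h1 := hS2 a (h - B (ContinuousLinearMap.adjoint R h)) (by simp [hRB])
    rw [map_sub, inner_sub_left, sub_eq_zero] at h1
    rw [h1, ← ContinuousLinearMap.adjoint_inner_right, ← ContinuousLinearMap.adjoint_inner_right,
      ContinuousLinearMap.adjoint_inner_left]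
  · obtain ⟨α, hα⟩ := hg
    obtain ⟨n, hn⟩ : ∃ n, n = g - (B - P.comp B) (ContinuousLinearMap.adjoint R g) := ⟨_, rfl⟩
    have hn0 : ContinuousLinearMap.adjoint R n = 0 := by
      rw [hn, map_sub, hS1, sub_self]
    have h1 : inner ℂ (q n) (q g) = 0 := by
      rw [hα, ← ContinuousLinearMap.adjoint_inner_left, hn0, inner_zero_left]
    have h2 : inner ℂ (q n) (q n) = 0 := by
      have e : q n = q g - q ((B - P.comp B) (ContinuousLinearMap.adjoint R g)) := by
        rw [hn, map_sub]
      rw [e, inner_sub_right, ← e, h1, hS2 _ n hn0, sub_zero]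
    have h3 : q n = 0 := inner_self_eq_zero.1 h2
    have h4 := hC n hn0
    rw [h3, norm_zero, mul_zero] at h4
    rw [norm_le_zero_iff.1 h4] at hn
    exact sub_eq_zero.1 hn.symm

/-! ### Test functions -/

/-- Fourier inversion on Schwartz functions, conjugated. -/
theorem fourierAt_conj_fourierAt {d : ℕ} (ψ : 𝓢(Rd d, ℂ)) (x : Rd d) :
    fourierAt (fun y => (starRingEnd ℂ) (fourierAt ψ y)) x = (starRingEnd ℂ) (ψ x) := by
  have hinv : ψ x = ∫ z, Complex.exp (((2 * Real.pi * inner ℝ z x : ℝ) : ℂ) * Complex.I) •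
      𝓕 (ψ : Rd d → ℂ) z := by
    have h1 : (𝓕⁻ (𝓕 ψ) : 𝓢(Rd d, ℂ)) x = ψ x := by rw [FourierTransform.fourierInv_fourier_eq]
    rw [← h1, SchwartzMap.fourierInv_coe, SchwartzMap.fourier_coe, Real.fourierInv_eq']
  have hpos : (0:ℝ) < (2 * Real.pi) ^ d := by positivity
  have hsc := Measure.integral_comp_smul (volume : Measure (Rd d)) (fun z =>
    Complex.exp (((2 * Real.pi * inner ℝ z x : ℝ) : ℂ) * Complex.I) • 𝓕 (ψ : Rd d → ℂ) z)
    (2 * Real.pi)⁻¹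
  rw [← hinv, finrank_euclideanSpace, Fintype.card_fin, inv_pow, inv_inv, abs_of_pos hpos] at hsc
  have hψ : ψ x = (((2 * Real.pi) ^ (-(d : ℝ) / 2) : ℝ) : ℂ) *
      ∫ y, fourierAt ψ y * Complex.exp (Complex.I * ((inner ℝ y x : ℝ) : ℂ)) := by
    have e : ∀ y : Rd d, fourierAt ψ y * Complex.exp (Complex.I * ((inner ℝ y x : ℝ) : ℂ)) =
        (((2 * Real.pi) ^ (-(d : ℝ) / 2) : ℝ) : ℂ) *
        (Complex.exp (((2 * Real.pi * inner ℝ ((2 * Real.pi)⁻¹ • y) x : ℝ) : ℂ) * Complex.I) •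
          𝓕 (ψ : Rd d → ℂ) ((2 * Real.pi)⁻¹ • y)) := by
      intro y
      rw [fourierAt_eq, inner_smul_left, conj_trivial,
        mul_inv_cancel_left₀ Real.two_pi_pos.ne', smul_eq_mul, mul_comm Complex.I]
      ring
    simp_rw [e]
    rw [integral_const_mul, hsc, ← mul_assoc, ← Complex.ofReal_mul, ← sq, two_pi_rpow_sq,
      Complex.real_smul, ← mul_assoc, ← Complex.ofReal_mul, inv_mul_cancel₀ hpos.ne',
      Complex.ofReal_one, one_mul]
  rw [hψ, map_mul, Complex.conj_ofReal, ← integral_conj, fourierAt]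
  congr 1
  refine integral_congr_ae (Filter.Eventually.of_forall fun y => ?_)
  simp only
  rw [map_mul, ← Complex.exp_conj, map_mul, Complex.conj_I, Complex.conj_ofReal]

theorem integrable_weight_fourierAt {d : ℕ} (k : ℕ) (ψ : 𝓢(Rd d, ℂ)) :
    Integrable fun y => (1 + ‖y‖ ^ 2) ^ k * ‖(starRingEnd ℂ) (fourierAt ψ y)‖ ^ 2 := by
  obtain ⟨β, hβ⟩ := exists_schwartz_eq_fourierAt ψ
  obtain ⟨W, hW⟩ := exists_schwartz_weight_mul_norm_sq k β
  refine (W.integrable (μ := volume)).norm.congr (Filter.Eventually.of_forall fun y => ?_)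
  simp only
  rw [hW, ← hβ, norm_mul, norm_mul, Complex.norm_real, RCLike.norm_conj,
    Real.norm_of_nonneg (by positivity), sq ‖β y‖]

theorem memLp_bracket_mul_conj_fourierAt {d : ℕ} (k : ℕ) (ψ : 𝓢(Rd d, ℂ)) :
    MemLp (fun y => ((bracket y ^ k : ℝ) : ℂ) * (starRingEnd ℂ) (fourierAt ψ y)) 2
      (volume : Measure (Rd d)) :=
  memLp_bracket_mul (Complex.continuous_conj.comp
    (continuous_fourierAt ψ.integrable)).aestronglyMeasurable (integrable_weight_fourierAt k ψ)

/-- The vector of `L²` belonging to the test function `conj ψ`: its pairing with an evaluation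
vector is a value of `conj ψ`. -/
noncomputable def testVec {d : ℕ} (k : ℕ) (ψ : 𝓢(Rd d, ℂ)) :
    Lp ℂ 2 (volume : Measure (Rd d)) := (memLp_bracket_mul_conj_fourierAt k ψ).toLp _

theorem inner_testVec_evalVec {d k : ℕ} (hk : d < 2 * k) (ψ : 𝓢(Rd d, ℂ)) (x : Rd d) :
    inner ℂ (testVec k ψ) (evalVec hk x) = ψ x := by
  rw [← inner_conj_symm, testVec, inner_evalVec_toLp, fourierAt_conj_fourierAt,
    Complex.conj_conj]

theorem inner_testVec {d : ℕ} (k : ℕ) (ψ : 𝓢(Rd d, ℂ)) (p : Lp ℂ 2 (volume : Measure (Rd d))) :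
    inner ℂ (testVec k ψ) p = ∫ y, ((bracket y ^ k : ℝ) : ℂ) * p y * fourierAt ψ y := by
  rw [L2.inner_def]
  refine integral_congr_ae ?_
  filter_upwards [(memLp_bracket_mul_conj_fourierAt k ψ).coeFn_toLp] with y hy
  rw [testVec, hy, RCLike.inner_apply, map_mul, Complex.conj_ofReal, Complex.conj_conj]
  ring

/-- The combination `∑ α_i δ_{p i}` applied to a test function is its pairing with `R α`. -/
theorem hasSum_mul_apply {d k : ℕ} (hk : d < 2 * k) {ι : Type} {p : ι → Rd d}
    {R : lp (fun _ : ι => ℂ) 2 →L[ℂ] Lp ℂ 2 (volume : Measure (Rd d))}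
    (hR : ∀ a, HasSum (fun i => a i • evalVec hk (p i)) (R a)) (α : lp (fun _ : ι => ℂ) 2)
    (ψ : 𝓢(Rd d, ℂ)) :
    HasSum (fun i => α i * ψ (p i)) (inner ℂ (testVec k ψ) (R α)) := by
  have h := (hR α).mapL (innerSL ℂ (testVec k ψ))
  refine h.congr_fun fun i => ?_
  simp [inner_testVec_evalVec]

/-- The energy form against a test function is the pairing of the density with the transform of
`D^k ψ`. -/
theorem inner_formOp_testVec {d : ℕ} {ε : ℝ} (hε : 0 ≤ ε) (k : ℕ) (ψ : 𝓢(Rd d, ℂ))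
    (g : Lp ℂ 2 (volume : Measure (Rd d))) :
    inner ℂ (formOp d hε k (testVec k ψ)) (formOp d hε k g) =
      ∫ y, densityOp d k g y * ((((‖y‖ ^ 2 + ε) ^ k : ℝ) : ℂ) * fourierAt ψ y) := by
  rw [inner_formOp_formOp]
  refine integral_congr_ae ?_
  filter_upwards [(memLp_bracket_mul_conj_fourierAt k ψ).coeFn_toLp, coeFn_densityOp k g]
    with y hy hy2
  have hb : ((bracket y : ℝ) : ℂ) ≠ 0 := by exact_mod_cast (bracket_pos y).ne'
  rw [testVec, hy, hy2, formFun_sq hε, map_mul, Complex.conj_ofReal, Complex.conj_conj]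
  push_cast
  field_simp

theorem integral_mul_opD {d : ℕ} {F : Rd d → ℂ} (hF : Integrable F) (ε : ℝ) (k : ℕ)
    (ψ : 𝓢(Rd d, ℂ)) :
    ∫ x, fourierAt F x * ((opD ε)^[k] ψ) x =
      ∫ y, F y * ((((‖y‖ ^ 2 + ε) ^ k : ℝ) : ℂ) * fourierAt ψ y) := by
  rw [← coe_opSchwartz_iterate, integral_fourierAt_mul hF ((opSchwartz ε)^[k] ψ).integrable]
  simp_rw [fourierAt_opSchwartz_iterate]

/-- The transforms of test functions separate `L²` functions with a polynomial weight: testing with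
all translates of `ψ` makes the Fourier transform of `(1 + ‖y‖²)^k e · fourierAt ψ` vanish. -/
theorem ae_eq_zero_of_integral_mul_fourierAt {d : ℕ} (k : ℕ) {e : Rd d → ℂ}
    (he : MemLp e 2 (volume : Measure (Rd d)))
    (h : ∀ ψ : 𝓢(Rd d, ℂ), HasCompactSupport ψ →
      ∫ y, (((1 + ‖y‖ ^ 2) ^ k : ℝ) : ℂ) * e y * fourierAt ψ y = 0) : e =ᵐ[volume] 0 := by
  -- bumps concentrating at the origin, so that their transforms have no common zero
  let χ : ℕ → ContDiffBump (0 : Rd d) := fun n =>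
    ⟨((n : ℝ) + 1)⁻¹ / 2, ((n : ℝ) + 1)⁻¹, by positivity, half_lt_self (by positivity)⟩
  have hχs : ∀ n, HasCompactSupport fun x => (χ n x : ℂ) := fun n =>
    (χ n).hasCompactSupport.comp_left Complex.ofReal_zero
  have hχd : ∀ n, ContDiff ℝ ∞ fun x => (χ n x : ℂ) := fun n =>
    Complex.ofRealCLM.contDiff.comp (χ n).contDiff
  let ψ : ℕ → 𝓢(Rd d, ℂ) := fun n => (hχs n).toSchwartzMap (hχd n)
  have hzero : ∀ n, ∀ᵐ y : Rd d, (((1 + ‖y‖ ^ 2) ^ k : ℝ) : ℂ) * e y * fourierAt (ψ n) y = 0 := by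
    intro n
    set H : Rd d → ℂ := fun y => (((1 + ‖y‖ ^ 2) ^ k : ℝ) : ℂ) * e y * fourierAt (ψ n) y with hH
    obtain ⟨β, hβ⟩ := exists_schwartz_eq_fourierAt (ψ n)
    let γ : 𝓢(Rd d, ℂ) := SchwartzMap.smulLeftCLM ℂ (fun y : Rd d => (1 + ‖y‖ ^ 2) ^ k) β
    have hγ : H = fun y => e y * γ y := by
      funext y
      simp only [hH, γ]
      rw [SchwartzMap.smulLeftCLM_apply_apply (by fun_prop), Complex.real_smul, ← hβ]
      ring
    have hH1 : Integrable H := by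
      rw [hγ]; exact he.integrable_mul (γ.memLp 2)
    have hH2 : MemLp H 2 := by
      rw [hγ]
      exact (γ.memLp_top volume).mul he
    have hFT : ∀ a, fourierAt H a = 0 := by
      intro a
      have hsh := h (SchwartzMap.compSubConstCLM ℂ a (ψ n)) (by
        have : (SchwartzMap.compSubConstCLM ℂ a (ψ n) : Rd d → ℂ) =
          (fun x => (χ n x : ℂ)) ∘ (Homeomorph.subRight a) := by
          funext x; simp [ψ]
        rw [this]
        exact (hχs n).comp_homeomorph _)
      have e1 : ∀ y, fourierAt (SchwartzMap.compSubConstCLM ℂ a (ψ n)) y =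
          fourierAt (ψ n) y * Complex.exp (-Complex.I * ((inner ℝ y a : ℝ) : ℂ)) := by
        intro y
        unfold fourierAt
        rw [mul_assoc, ← integral_mul_const]
        congr 1
        rw [← integral_sub_right_eq_self (fun x => ψ n x *
          Complex.exp (-Complex.I * ((inner ℝ x y : ℝ) : ℂ)) *
          Complex.exp (-Complex.I * ((inner ℝ y a : ℝ) : ℂ))) a]
        refine integral_congr_ae (Filter.Eventually.of_forall fun x => ?_)
        simp only [SchwartzMap.compSubConstCLM_apply]
        rw [mul_assoc, ← Complex.exp_add, inner_sub_left, real_inner_comm y a]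
        congr 2
        push_cast
        ring
      simp_rw [e1, ← mul_assoc] at hsh
      rw [fourierAt, hsh, mul_zero]
    have h0 := integral_norm_sq_fourierAt hH1 hH2
    simp_rw [hFT] at h0
    simp only [norm_zero, ne_eq, OfNat.ofNat_ne_zero, not_false_eq_true, zero_pow,
      integral_zero] at h0
    have h1 := (integral_eq_zero_iff_of_nonneg (fun y => by positivity)
      ((memLp_two_iff_integrable_sq_norm hH2.1).1 hH2)).1 h0.symm
    filter_upwards [h1] with y hy
    have hHy : H y = 0 := by simpa using hy
    exact hHy
  have hne : ∀ y : Rd d, ∃ n, fourierAt (ψ n) y ≠ 0 := by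
    intro y
    obtain ⟨n, hn⟩ := exists_nat_ge (2 * ‖y‖)
    refine ⟨n, fun h0 => ?_⟩
    have hI0 : 0 < ∫ x, χ n x := (χ n).integral_pos
    have hc : (((2 * Real.pi) ^ (-(d : ℝ) / 2) : ℝ) : ℂ) ≠ 0 := by
      exact_mod_cast (by positivity : (0:ℝ) < (2 * Real.pi) ^ (-(d : ℝ) / 2)).ne'
    rw [fourierAt] at h0
    have h1 := (mul_eq_zero.1 h0).resolve_left hc
    have hint := integrable_mul_exp_inner (ψ n).integrable y
    have h2 : ‖∫ x, (ψ n x * Complex.exp (-Complex.I * ((inner ℝ x y : ℝ) : ℂ)) - ψ n x)‖ ≤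
        ∫ x, (1 / 2) * χ n x := by
      refine norm_integral_le_of_norm_le ((χ n).integrable.const_mul _)
        (Filter.Eventually.of_forall fun x => ?_)
      have e1 : ψ n x * Complex.exp (-Complex.I * ((inner ℝ x y : ℝ) : ℂ)) - ψ n x =
          (χ n x : ℂ) * (Complex.exp (Complex.I * ((-inner ℝ x y : ℝ) : ℂ)) - 1) := by
        simp only [ψ, HasCompactSupport.toSchwartzMap_toFun]
        push_cast
        ring_nf
      rw [e1, norm_mul, Complex.norm_real, Real.norm_of_nonneg (χ n).nonneg, mul_comm]
      by_cases hx : χ n x = 0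
      · simp [hx]
      · refine mul_le_mul_of_nonneg_right ?_ (χ n).nonneg
        refine (Real.norm_exp_I_mul_ofReal_sub_one_le).trans ?_
        have hx1 : ‖x‖ < ((n : ℝ) + 1)⁻¹ := by
          by_contra hcon
          push Not at hcon
          exact hx ((χ n).zero_of_le_dist (by rw [dist_zero_right]; exact hcon))
        rw [norm_neg]
        refine (norm_inner_le_norm x y).trans ?_
        calc ‖x‖ * ‖y‖ ≤ ((n : ℝ) + 1)⁻¹ * (n / 2) := by
              gcongr
              linarith
          _ ≤ 1 / 2 := by
              rw [inv_mul_le_iff₀ (by positivity)]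
              linarith
    rw [integral_sub hint (ψ n).integrable, h1, zero_sub, norm_neg, integral_const_mul] at h2
    have h3 : ∫ x, ψ n x = ((∫ x, χ n x : ℝ) : ℂ) := by
      rw [← integral_complex_ofReal]
      rfl
    rw [h3, Complex.norm_real, Real.norm_of_nonneg hI0.le] at h2
    linarith
  filter_upwards [ae_all_iff.2 hzero] with y hy
  obtain ⟨n, hn⟩ := hne y
  have := (mul_eq_zero.1 (hy n)).resolve_right hn
  refine (mul_eq_zero.1 this).resolve_left ?_
  exact_mod_cast (by positivity : (0:ℝ) < (1 + ‖y‖ ^ 2) ^ k).ne'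

/-! ### Characterization of Lagrangian splines -/

section Characterization

variable {d k : ℕ} (hk : d < 2 * k) {ε : ℝ} (hε : 0 ≤ ε) {X : Set (Rd d)}
  {R : lp (fun _ : X => ℂ) 2 →L[ℂ] Lp ℂ 2 (volume : Measure (Rd d))}

/-- Energy minimality in weak form, `⟪q h, q g⟫ = ⟪h, R α⟫` for all `h`, is the distributional
equation `D^k L = ∑ α_x δ_x` for `L = fourierAt (densityOp d k g)`. -/
theorem isLagrangianSpline_fourierAt
    (hR : ∀ a, HasSum (fun i : X => a i • evalVec hk (i : Rd d)) (R a)) {ν : X}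
    {g : Lp ℂ 2 (volume : Measure (Rd d))} {α : lp (fun _ : X => ℂ) 2}
    (hα : ∀ h, inner ℂ (formOp d hε k h) (formOp d hε k g) = inner ℂ h (R α))
    (hν : fourierAt (densityOp d k g) ν = 1)
    (hμ : ∀ x : X, x ≠ ν → fourierAt (densityOp d k g) x = 0) :
    IsLagrangianSpline ε k X ν (fourierAt (densityOp d k g)) where
  continuous := continuous_fourierAt (integrable_densityOp hk g)
  memLp := memLp_fourierAt (integrable_densityOp hk g) (Lp.memLp _)
  solves := by
    refine ⟨α, summable_norm_sq_lp α, fun ψ hψ hψs => ?_⟩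
    have h := hasSum_mul_apply hk hR α (hψs.toSchwartzMap hψ)
    rw [← hα, inner_formOp_testVec, ← integral_mul_opD (integrable_densityOp hk g)] at h
    exact h
  apply_self := hν
  apply_of_ne := hμ

/-- A Lagrangian spline has Sobolev regularity of order `k`: comparing the transform of the
equation `D^k L = ∑ α_x δ_x` on both sides shows that the density `G` of `L` satisfies
`(‖y‖² + ε)^k G = ⟨y⟩^k R α` almost everywhere. -/
theorem IsLagrangianSpline.exists_density
    (hR : ∀ a, HasSum (fun i : X => a i • evalVec hk (i : Rd d)) (R a)) {ν : X} {L : Rd d → ℂ}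
    (hL : IsLagrangianSpline ε k X ν L) :
    ∃ (g : Lp ℂ 2 (volume : Measure (Rd d))) (α : lp (fun _ : X => ℂ) 2),
      (∀ h, inner ℂ (formOp d hε k h) (formOp d hε k g) = inner ℂ h (R α)) ∧
      L = fourierAt (densityOp d k g) ∧ fourierInvL2 (hL.memLp.toLp L) = densityOp d k g := by
  obtain ⟨α₀, hα₀, hsol⟩ := hL.solves
  let α : lp (fun _ : X => ℂ) 2 := ⟨α₀, memℓp_gen (by simpa using hα₀)⟩
  set G := fourierInvL2 (hL.memLp.toLp L) with hG
  set p := R α with hp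
  have hbr : ∀ y : Rd d, ((bracket y ^ k : ℝ) : ℂ) ≠ 0 := fun y => by
    exact_mod_cast (pow_pos (bracket_pos y) k).ne'
  -- the difference of the two sides, divided by a polynomial weight
  set q := formOp d hε k with hq
  set e := q (q G) - densityOp d k p with he
  have hecoe : ∀ᵐ y, (((1 + ‖y‖ ^ 2) ^ k : ℝ) : ℂ) * e y =
      (((‖y‖ ^ 2 + ε) ^ k : ℝ) : ℂ) * G y - ((bracket y ^ k : ℝ) : ℂ) * p y := by
    filter_upwards [Lp.coeFn_sub (q (q G)) (densityOp d k p), coeFn_formOp hε k G,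
      coeFn_formOp hε k (q G), coeFn_densityOp k p] with y h1 h2 h3 h4
    rw [he, h1, Pi.sub_apply, h3, h2, h4, ← mul_assoc (formFun ε k y : ℂ), ← Complex.ofReal_mul,
      ← sq (formFun ε k y), formFun_sq hε, ← bracket_pow_sq]
    push_cast
    have := hbr y
    push_cast at this
    field_simp
  have hzero : (e : Rd d → ℂ) =ᵐ[volume] 0 := by
    refine ae_eq_zero_of_integral_mul_fourierAt k (Lp.memLp e) fun ψ hψs => ?_
    have h1 := hasSum_mul_apply hk hR α ψ
    have h2 := hsol ψ (ψ.smooth ⊤) hψs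
    have h3 := h2.unique h1
    rw [inner_testVec, ← hp] at h3
    have h4 : ∫ y, L y * ((opD ε)^[k] ψ) y =
        ∫ y, G y * ((((‖y‖ ^ 2 + ε) ^ k : ℝ) : ℂ) * fourierAt ψ y) := by
      simp_rw [← fourierAt_opSchwartz_iterate]
      rw [hG, ← integral_mul_eq_fourierInvL2]
      refine integral_congr_ae ?_
      filter_upwards [hL.memLp.coeFn_toLp] with y hy
      rw [hy, coe_opSchwartz_iterate]
    rw [h4] at h3
    have hi1 : Integrable fun y => G y * ((((‖y‖ ^ 2 + ε) ^ k : ℝ) : ℂ) * fourierAt ψ y) := by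
      obtain ⟨β, hβ⟩ := exists_schwartz_eq_fourierAt ((opSchwartz ε)^[k] ψ)
      simp_rw [← fourierAt_opSchwartz_iterate, ← hβ]
      exact (Lp.memLp G).integrable_mul (β.memLp 2)
    have hi2 : Integrable fun y => ((bracket y ^ k : ℝ) : ℂ) * p y * fourierAt ψ y := by
      have := (Lp.memLp p).integrable_mul (memLp_bracket_mul
        (continuous_fourierAt ψ.integrable).aestronglyMeasurable (k := k)
        (by simpa using integrable_weight_fourierAt k ψ))
      refine this.congr (Filter.Eventually.of_forall fun y => ?_)
      simp only [Pi.mul_apply]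
      ring
    rw [← sub_eq_zero, ← integral_sub hi1 hi2] at h3
    rw [← h3]
    refine integral_congr_ae ?_
    filter_upwards [hecoe] with y hy
    rw [hy]
    ring
  have hEq : ∀ᵐ y, (((‖y‖ ^ 2 + ε) ^ k : ℝ) : ℂ) * G y = ((bracket y ^ k : ℝ) : ℂ) * p y := by
    filter_upwards [hecoe, hzero] with y h1 h2
    rw [h2, Pi.zero_apply, mul_zero] at h1
    exact sub_eq_zero.1 h1.symm
  have hGm := Lp.aestronglyMeasurable G
  have hGw : Integrable fun y => (1 + ‖y‖ ^ 2) ^ k * ‖G y‖ ^ 2 := by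
    have i1 := (memLp_two_iff_integrable_sq_norm hGm).1 (Lp.memLp G)
    have i2 := (memLp_two_iff_integrable_sq_norm (Lp.aestronglyMeasurable p)).1 (Lp.memLp p)
    refine ((i1.const_mul (2 ^ k)).add (i2.const_mul ((2 ^ k) ^ 2))).mono'
      (AEStronglyMeasurable.mul (by fun_prop) (hGm.norm.pow 2)) ?_
    filter_upwards [hEq] with y hy
    rw [Real.norm_of_nonneg (by positivity)]
    simp only [Pi.add_apply]
    rcases le_total (‖y‖ ^ 2) 1 with hy1 | hy1
    · have : (1 + ‖y‖ ^ 2) ^ k ≤ 2 ^ k := by gcongr; linarith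
      have h5 : (1 + ‖y‖ ^ 2) ^ k * ‖G y‖ ^ 2 ≤ 2 ^ k * ‖G y‖ ^ 2 := by gcongr
      have : 0 ≤ ((2:ℝ) ^ k) ^ 2 * ‖p y‖ ^ 2 := by positivity
      linarith
    · have h6 : (1 + ‖y‖ ^ 2) ^ k ≤ 2 ^ k * (‖y‖ ^ 2 + ε) ^ k := by
        rw [← mul_pow]; gcongr; linarith
      have h7 : (‖y‖ ^ 2 + ε) ^ k * ‖G y‖ = bracket y ^ k * ‖p y‖ := by
        have := congrArg norm hy
        have hb := bracket_pos y
        rwa [norm_mul, norm_mul, Complex.norm_real, Complex.norm_real,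
          Real.norm_of_nonneg (by positivity), Real.norm_of_nonneg (by positivity)] at this
      have hb := pow_pos (bracket_pos y) k
      have h8 : bracket y ^ k * ‖G y‖ ≤ 2 ^ k * ‖p y‖ := by
        refine le_of_mul_le_mul_left ?_ hb
        rw [← mul_assoc, ← sq, bracket_pow_sq]
        calc (1 + ‖y‖ ^ 2) ^ k * ‖G y‖ ≤ 2 ^ k * (‖y‖ ^ 2 + ε) ^ k * ‖G y‖ := by gcongr
          _ = 2 ^ k * ((‖y‖ ^ 2 + ε) ^ k * ‖G y‖) := by ring
          _ = _ := by rw [h7]; ring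
      have h9 : (1 + ‖y‖ ^ 2) ^ k * ‖G y‖ ^ 2 ≤ (2 ^ k) ^ 2 * ‖p y‖ ^ 2 := by
        rw [← bracket_pow_sq, ← mul_pow, ← mul_pow]
        gcongr
      have : 0 ≤ (2:ℝ) ^ k * ‖G y‖ ^ 2 := by positivity
      linarith
  have hmem := memLp_bracket_mul hGm hGw
  have hJ : densityOp d k (hmem.toLp _) = G := by
    refine Lp.ext ?_
    filter_upwards [coeFn_densityOp k (hmem.toLp _), hmem.coeFn_toLp] with y h1 h2
    rw [h1, h2, Complex.ofReal_inv, inv_mul_cancel_left₀ (hbr y)]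
  refine ⟨hmem.toLp _, α, fun h => ?_, ?_, ?_⟩
  · rw [inner_formOp_formOp, L2.inner_def]
    refine integral_congr_ae ?_
    filter_upwards [hmem.coeFn_toLp, hEq] with y h1 h2
    rw [h1, RCLike.inner_apply, formFun_sq hε]
    have h3 : p y = ((bracket y ^ k : ℝ) : ℂ)⁻¹ * ((((‖y‖ ^ 2 + ε) ^ k : ℝ) : ℂ) * G y) := by
      rw [h2, inv_mul_cancel_left₀ (hbr y)]
    rw [← hp, h3]
    have := hbr y
    push_cast at this ⊢
    field_simp
  · rw [hJ]
    have hG1 : Integrable G := integrable_of_integrable_weight hk hGm hGw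
    have h1 := fourierInvL2_fourierAt hG1 (Lp.memLp G)
    rw [Lp.toLp_coeFn] at h1
    have h2 := fourierInvL2_injective (h1.trans hG)
    have h3 : fourierAt G =ᵐ[volume] L := by
      have h4 := (memLp_fourierAt hG1 (Lp.memLp G)).coeFn_toLp
      rw [h2] at h4
      exact h4.symm.trans hL.memLp.coeFn_toLp
    exact ((continuous_fourierAt hG1).ae_eq_iff_eq volume hL.continuous).1 h3 |>.symm
  · rw [hJ]

end Characterization

/-! ### Existence, uniqueness and error of the spline interpolant -/

set_option maxHeartbeats 400000 in
/-- For a set on which the Poincaré inequality holds, the sampling operator `R†`, whose coordinates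
are the values of `fourierAt (densityOp d k g)`, and the spline operator `S` of the energy. -/
theorem exists_sampling_and_spline_operator {d k : ℕ} (hk : d < 2 * k) {ε : ℝ} (hε : 0 ≤ ε)
    {X : Set (Rd d)} {δ : ℝ} (hδ : 0 < δ) (hX : ∀ x ∈ X, ∀ y ∈ X, x ≠ y → δ ≤ dist x y)
    {B : ℝ} (hB : 0 ≤ B)
    (hker : ∀ n : Lp ℂ 2 (volume : Measure (Rd d)),
      (∀ x ∈ X, fourierAt (densityOp d k n) x = 0) →
        ‖densityOp d k n‖ ^ 2 ≤ B * ‖formOp d hε k n‖ ^ 2) :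
    ∃ (R : lp (fun _ : X => ℂ) 2 →L[ℂ] Lp ℂ 2 (volume : Measure (Rd d)))
      (S : lp (fun _ : X => ℂ) 2 →L[ℂ] Lp ℂ 2 (volume : Measure (Rd d))),
      (∀ a, HasSum (fun i : X => a i • evalVec hk (i : Rd d)) (R a)) ∧
      (∀ g (x : X), ContinuousLinearMap.adjoint R g x = fourierAt (densityOp d k g) x) ∧
      (∀ a, ContinuousLinearMap.adjoint R (S a) = a) ∧
      (∀ a n, ContinuousLinearMap.adjoint R n = 0 →
        inner ℂ (formOp d hε k n) (formOp d hε k (S a)) = 0) ∧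
      (∀ a, ∃ α, ∀ h, inner ℂ (formOp d hε k h) (formOp d hε k (S a)) = inner ℂ h (R α)) ∧
      ∀ g, (∃ α, ∀ h, inner ℂ (formOp d hε k h) (formOp d hε k g) = inner ℂ h (R α)) →
        g = S (ContinuousLinearMap.adjoint R g) := by
  obtain ⟨R, T, hR, hRT⟩ := exists_sampling_system hk (fun x : X => (x : Rd d)) hδ
    fun i j hij => hX i i.2 j j.2 fun h => hij (Subtype.ext h)
  have hadj : ∀ g (x : X), ContinuousLinearMap.adjoint R g x =
      fourierAt (densityOp d k g) x := fun g x => by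
    rw [adjoint_synthesis_apply hR g x, inner_evalVec_eq_fourierAt_densityOp]
  have hC : ∀ n, ContinuousLinearMap.adjoint R n = 0 →
      ‖n‖ ≤ (√(2 ^ k * (B + 1))).toNNReal * ‖formOp d hε k n‖ := fun n hn => by
    have h := norm_sq_le_of_poincare hε k n (hker n fun x hx => by
      rw [← hadj n ⟨x, hx⟩, hn, lp.coeFn_zero, Pi.zero_apply])
    have h' := Real.sqrt_le_sqrt h
    rwa [Real.sqrt_sq (norm_nonneg _), Real.sqrt_mul (by positivity),
      Real.sqrt_sq (norm_nonneg _), ← Real.coe_toNNReal _ (Real.sqrt_nonneg _)] at h'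
  obtain ⟨S, h1, h2, h3, h4⟩ := exists_spline_operator R T hRT (formOp d hε k) hC
  exact ⟨R, S, hR, hadj, h1, h2, h3, h4⟩

/-- A square integrable function of bounded support is a density: the weight `⟨y⟩^k` is bounded on
the support. -/
theorem exists_densityOp_eq {d k : ℕ} {σ : ℝ} {φ : Lp ℂ 2 (volume : Measure (Rd d))}
    (hφ : ∀ᵐ x, x ∉ Metric.closedBall (0 : Rd d) σ → φ x = 0) :
    ∃ g, densityOp d k g = φ := by
  have hw : Integrable fun y => (1 + ‖y‖ ^ 2) ^ k * ‖φ y‖ ^ 2 := by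
    refine (((memLp_two_iff_integrable_sq_norm (Lp.aestronglyMeasurable φ)).1
      (Lp.memLp φ)).const_mul ((1 + σ ^ 2) ^ k)).mono'
      (AEStronglyMeasurable.mul (by fun_prop) ((Lp.aestronglyMeasurable φ).norm.pow 2)) ?_
    filter_upwards [hφ] with y hy
    rw [Real.norm_of_nonneg (by positivity)]
    by_cases hyσ : y ∈ Metric.closedBall (0 : Rd d) σ
    · rw [mem_closedBall_zero_iff] at hyσ
      gcongr
    · simp [hy hyσ]
  have hmem := memLp_bracket_mul (Lp.aestronglyMeasurable φ) hw
  refine ⟨hmem.toLp _, Lp.ext ?_⟩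
  filter_upwards [coeFn_densityOp k (hmem.toLp _), hmem.coeFn_toLp] with y h1 h2
  have hb : ((bracket y ^ k : ℝ) : ℂ) ≠ 0 := by exact_mod_cast (pow_pos (bracket_pos y) k).ne'
  rw [h1, h2, Complex.ofReal_inv, inv_mul_cancel_left₀ hb]

/-- The energy form against a density supported in the ball of radius `σ`: the symbol
`(‖y‖² + ε)^k` is at most `(σ² + ε)^k` there. -/
theorem norm_inner_formOp_le {d k : ℕ} {ε : ℝ} (hε : 0 ≤ ε) {σ : ℝ}
    (n : Lp ℂ 2 (volume : Measure (Rd d))) {g : Lp ℂ 2 (volume : Measure (Rd d))}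
    (hg : ∀ᵐ x, x ∉ Metric.closedBall (0 : Rd d) σ → densityOp d k g x = 0) :
    ‖inner ℂ (formOp d hε k n) (formOp d hε k g)‖ ≤
      (σ ^ 2 + ε) ^ k * ‖densityOp d k n‖ * ‖densityOp d k g‖ := by
  set u := densityOp d k n
  set v := densityOp d k g
  have hpt : ∀ᵐ y, ‖(starRingEnd ℂ) (n y) * (((formFun ε k y) ^ 2 : ℝ) : ℂ) * g y‖ ≤
      (σ ^ 2 + ε) ^ k * (‖u y‖ * ‖v y‖) := by
    filter_upwards [coeFn_densityOp k n, coeFn_densityOp k g, hg] with y h1 h2 h3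
    have hb : 0 ≤ (bracket y ^ k)⁻¹ := inv_nonneg.2 (pow_pos (bracket_pos y) k).le
    have h4 : ‖(starRingEnd ℂ) (n y) * (((formFun ε k y) ^ 2 : ℝ) : ℂ) * g y‖ =
        (‖y‖ ^ 2 + ε) ^ k * (‖u y‖ * ‖v y‖) := by
      rw [h1, h2, formFun_sq hε]
      rw [norm_mul, norm_mul, norm_mul, norm_mul, RCLike.norm_conj, Complex.norm_real,
        Complex.norm_real, Real.norm_of_nonneg hb, Real.norm_of_nonneg (by positivity)]
      ring
    rw [h4]
    by_cases hy : y ∈ Metric.closedBall (0 : Rd d) σ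
    · rw [mem_closedBall_zero_iff] at hy
      gcongr
    · simp [h3 hy]
  have hu := (Lp.memLp u).norm
  have hv := (Lp.memLp v).norm
  have hi : Integrable fun y => ‖u y‖ * ‖v y‖ := hu.integrable_mul hv
  rw [inner_formOp_formOp]
  calc _ ≤ ∫ y, (σ ^ 2 + ε) ^ k * (‖u y‖ * ‖v y‖) :=
        norm_integral_le_of_norm_le (hi.const_mul _) hpt
    _ = (σ ^ 2 + ε) ^ k * ∫ y, ‖u y‖ * ‖v y‖ := integral_const_mul _ _
    _ ≤ (σ ^ 2 + ε) ^ k * (‖u‖ * ‖v‖) := by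
        have := integral_mul_le_Lp_mul_Lq_of_nonneg (μ := volume) Real.HolderConjugate.two_two
          (Filter.Eventually.of_forall fun y => norm_nonneg (u y))
          (Filter.Eventually.of_forall fun y => norm_nonneg (v y))
          (by simpa using hu) (by simpa using hv)
        simp only [Real.rpow_two, ← norm_sq_eq_integral, ← Real.sqrt_eq_rpow,
          Real.sqrt_sq (norm_nonneg _)] at this
        gcongr
    _ = _ := by ring

set_option maxHeartbeats 400000 in
/-- Existence and uniqueness of the Lagrangian splines of order `k`, and the error of the spline
interpolant, from the Poincaré inequality with constant `B` on functions vanishing on `X`. With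
`n = g - S a` the error vector, orthogonality gives `‖q n‖² = ⟪q n, q g⟫`, which is bounded by
`(σ² + ε)^k ‖densityOp n‖ ‖φ‖`; one factor `‖densityOp n‖` cancels. -/
theorem existsUnique_isLagrangianSpline_and_hasSum {d k : ℕ} (hk : d < 2 * k) {ε : ℝ}
    (hε : 0 ≤ ε) {X : Set (Rd d)} {δ : ℝ} (hδ : 0 < δ)
    (hX : ∀ x ∈ X, ∀ y ∈ X, x ≠ y → δ ≤ dist x y) {B : ℝ} (hB : 0 ≤ B)
    (hker : ∀ n : Lp ℂ 2 (volume : Measure (Rd d)),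
      (∀ x ∈ X, fourierAt (densityOp d k n) x = 0) →
        ‖densityOp d k n‖ ^ 2 ≤ B * ‖formOp d hε k n‖ ^ 2) :
    (∀ ν : X, ∃! L, IsLagrangianSpline ε k X ν L) ∧
    ∀ (L : X → Rd d → ℂ) (hL : ∀ ν, IsLagrangianSpline ε k X ν (L ν)) (σ : ℝ)
      (φ : Lp ℂ 2 (volume : Measure (Rd d))),
      (∀ᵐ x, x ∉ Metric.closedBall (0 : Rd d) σ → φ x = 0) →
      ∃ S, HasSum (fun ν : X => fourierAt φ ν •
          fourierInvL2 ((hL ν).memLp.toLp (L ν))) S ∧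
        ‖φ - S‖ ≤ B * (σ ^ 2 + ε) ^ k * ‖φ‖ := by
  classical
  obtain ⟨R, S, hR, hadj, hRS, horth, hrep, huniq⟩ :=
    exists_sampling_and_spline_operator hk hε hδ hX hB hker
  -- every Lagrangian spline has the samples `e_ν` and is a spline vector, hence is `S e_ν`
  have hchar : ∀ {ν : X} {L : Rd d → ℂ} (hL : IsLagrangianSpline ε k X ν L),
      L = fourierAt (densityOp d k (S (lp.single 2 ν 1))) ∧
        fourierInvL2 (hL.memLp.toLp L) = densityOp d k (S (lp.single 2 ν 1)) := by
    intro ν L hL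
    obtain ⟨g, α, h1, h2, h3⟩ := hL.exists_density hk hε hR
    have hg : ContinuousLinearMap.adjoint R g = lp.single 2 ν 1 := by
      ext x
      rw [hadj, ← h2, lp.single_apply]
      by_cases hx : x = ν
      · subst hx
        simpa using hL.apply_self
      · simpa [hx] using hL.apply_of_ne x hx
    have h4 := huniq g ⟨α, h1⟩
    rw [hg] at h4
    rw [← h4]
    exact ⟨h2, h3⟩
  refine ⟨fun ν => ⟨fourierAt (densityOp d k (S (lp.single 2 ν 1))), ?_,
    fun L hL => (hchar hL).1⟩, ?_⟩
  · obtain ⟨α, hα⟩ := hrep (lp.single 2 ν 1)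
    refine isLagrangianSpline_fourierAt hk hε hR hα ?_ fun x hx => ?_
    · rw [← hadj, hRS, lp.single_apply_self]
    · rw [← hadj, hRS, lp.single_apply_ne _ _ _ hx]
  · intro L hL σ φ hφ
    obtain ⟨g, rfl⟩ := exists_densityOp_eq (k := k) hφ
    set a := ContinuousLinearMap.adjoint R g with ha
    refine ⟨densityOp d k (S a), ?_, ?_⟩
    -- the series is the image of `a = ∑ a_ν e_ν` under a bounded operator
    · have h := (lp.hasSum_single ENNReal.ofNat_ne_top a).mapL (densityOp d k ∘L S)
      have hterm : ∀ ν : X, fourierAt (densityOp d k g) ν •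
          fourierInvL2 ((hL ν).memLp.toLp (L ν)) =
            (densityOp d k ∘L S) (lp.single 2 ν (a ν)) := fun ν => by
        rw [(hchar (hL ν)).2, ← hadj, ← ha, ContinuousLinearMap.comp_apply, ← map_smul,
          ← map_smul, ← lp.single_smul, smul_eq_mul, mul_one]
      simp_rw [hterm]
      exact h
    · set n := g - S a with hn
      have hn0 : ContinuousLinearMap.adjoint R n = 0 := by
        rw [hn, map_sub, hRS, ha, sub_self]
      have h1 := hker n fun x hx => by
        rw [← hadj n ⟨x, hx⟩, hn0, lp.coeFn_zero, Pi.zero_apply]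
      have h2 : ‖formOp d hε k n‖ ^ 2 ≤
          (σ ^ 2 + ε) ^ k * ‖densityOp d k n‖ * ‖densityOp d k g‖ := by
        refine le_trans (le_of_eq ?_) (norm_inner_formOp_le hε n hφ)
        have h3 : inner ℂ (formOp d hε k n) (formOp d hε k g) =
            inner ℂ (formOp d hε k n) (formOp d hε k n) := by
          have he : formOp d hε k g = formOp d hε k n + formOp d hε k (S a) := by
            rw [hn, map_sub, sub_add_cancel]
          rw [he, inner_add_right, horth a n hn0, add_zero]
        rw [h3, inner_self_eq_norm_sq_to_K]
        simp
      rw [← map_sub, ← hn]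
      rcases eq_or_lt_of_le (norm_nonneg (densityOp d k n)) with h0 | h0
      · rw [← h0]; positivity
      · refine le_of_mul_le_mul_left ?_ h0
        calc _ = ‖densityOp d k n‖ ^ 2 := by ring
          _ ≤ _ := h1.trans (mul_le_mul_of_nonneg_left h2 hB)
          _ = _ := by ring

end IrregularSampling


theorem theorem3p1 (d : ℕ) (hd : 1 ≤ d) (ε : ℝ) (hε : 0 ≤ ε) :
    ∃ c : ℝ, 0 < c ∧
      ∀ (σ lam : ℝ), 0 < σ → 0 < lam → lam < (c * (σ + ε))⁻¹ →
      ∀ Ξ : Set (IrregularSampling.Rd d), IrregularSampling.IsKnotSet Ξ lam →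
      ∀ r : ℕ, d / 2 + 1 ≤ r →
        -- the Lagrangian splines exist and are unique
        (∀ (l : ℕ) (ν : Ξ), ∃! L : IrregularSampling.Rd d → ℂ,
          IrregularSampling.IsLagrangianSpline ε (2 ^ l * r) Ξ ν L) ∧
        -- the summation formula with its error bound
        ∀ (L : ℕ → Ξ → IrregularSampling.Rd d → ℂ)
          (hL : ∀ (l : ℕ) (ν : Ξ),
            IrregularSampling.IsLagrangianSpline ε (2 ^ l * r) Ξ ν (L l ν))
          (φ : MeasureTheory.Lp ℂ 2
            (MeasureTheory.volume : MeasureTheory.Measure (IrregularSampling.Rd d))),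
          (∀ᵐ x, x ∉ Metric.closedBall (0 : IrregularSampling.Rd d) σ → φ x = 0) →
          ∃ S : ℕ → MeasureTheory.Lp ℂ 2
              (MeasureTheory.volume : MeasureTheory.Measure (IrregularSampling.Rd d)),
            (∀ l : ℕ, HasSum
              (fun ν : Ξ => IrregularSampling.fourierAt φ ν •
                IrregularSampling.fourierInvL2 ((hL l ν).memLp.toLp (L l ν))) (S l)) ∧
            Filter.Tendsto S Filter.atTop (nhds φ) ∧
            ∀ l : ℕ, ‖φ - S l‖ ≤ 2 * (c * lam * (σ + ε)) ^ (2 ^ (l + 1) * r) * ‖φ‖ := by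
  classical
  obtain ⟨A, hA, hP⟩ := IrregularSampling.exists_poincare (d := d) (s := d / 2 + 1) (by omega)
  -- `M` is chosen so that `σ² + ε ≤ M² (σ + ε)²`; for `ε = 0` the convention `1 / 0 = 0` gives `M = 1`
  set M : ℝ := 1 + 1 / √ε with hM
  have hM0 : 0 < M := by positivity
  have hMsq : ∀ σ : ℝ, 0 < σ → σ ^ 2 + ε ≤ (M * (σ + ε)) ^ 2 := by
    intro σ hσ
    rcases eq_or_lt_of_le hε with h0 | h0
    · simp [hM, ← h0]
    · have hs := Real.sqrt_pos.2 h0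
      have hss := Real.sq_sqrt hε
      have h1 : σ + √ε ≤ M * (σ + ε) := by
        have : M * (σ + ε) = σ + ε + σ / √ε + √ε := by
          rw [hM]; field_simp; rw [hss]; ring
        rw [this]
        have : 0 ≤ σ / √ε := by positivity
        linarith
      calc σ ^ 2 + ε ≤ (σ + √ε) ^ 2 := by nlinarith
        _ ≤ _ := by gcongr
  refine ⟨A * M, by positivity, fun σ lam hσ hlam hlt Ξ hΞ r hr => ?_⟩
  obtain ⟨δ, hδ, hsep⟩ := hΞ.separated
  have hrl : ∀ l : ℕ, r ≤ 2 ^ l * r := fun l => Nat.le_mul_of_pos_left r (by positivity)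
  have hkl : ∀ l : ℕ, d < 2 * (2 ^ l * r) := fun l => by have := hrl l; omega
  have hmain := fun l : ℕ =>
    IrregularSampling.existsUnique_isLagrangianSpline_and_hasSum (hkl l) hε hδ hsep
      (B := (A * lam) ^ (2 * (2 ^ l * r))) (by positivity) fun n hn => by
        rw [IrregularSampling.norm_sq_eq_integral]
        refine (hP lam hlam Ξ hΞ.countable hΞ.exists_dist_le _ (hr.trans (hrl l)) _
          (Lp.aestronglyMeasurable _) (IrregularSampling.integrable_weight_densityOp _ n)
          hn).trans ?_
        gcongr
        exact IrregularSampling.integral_le_norm_formOp_sq hε _ n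
  refine ⟨fun l => (hmain l).1, fun L hL φ hφ => ?_⟩
  choose S hS hSn using fun l => (hmain l).2 (L l) (hL l) σ φ hφ
  set t := A * M * lam * (σ + ε) with ht
  have hσε : 0 < σ + ε := by positivity
  have ht0 : 0 ≤ t := by positivity
  have ht1 : t < 1 := by
    rw [lt_inv_comm₀ hlam (by positivity), ← one_div, lt_div_iff₀ hlam] at hlt
    rw [ht]; linarith
  have hbound : ∀ l, ‖φ - S l‖ ≤ t ^ (2 ^ (l + 1) * r) * ‖φ‖ := fun l => by
    refine (hSn l).trans ?_
    gcongr
    calc _ ≤ (A * lam) ^ (2 * (2 ^ l * r)) * ((M * (σ + ε)) ^ 2) ^ (2 ^ l * r) := by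
          gcongr
          exact hMsq σ hσ
      _ = t ^ (2 ^ (l + 1) * r) := by
          rw [← pow_mul, ← mul_pow, ht]
          congr 1 <;> ring
  refine ⟨S, hS, ?_, fun l => (hbound l).trans ?_⟩
  · rw [tendsto_iff_norm_sub_tendsto_zero]
    have he : Filter.Tendsto (fun l : ℕ => 2 ^ (l + 1) * r) Filter.atTop Filter.atTop := by
      refine Filter.tendsto_atTop_mono (fun l => ?_) Filter.tendsto_id
      have := (Nat.lt_two_pow_self (n := l + 1))
      have hr1 : 1 ≤ r := by omega
      simp only [id]
      nlinarith
    have := ((tendsto_pow_atTop_nhds_zero_of_lt_one ht0 ht1).comp he).mul_const ‖φ‖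
    rw [zero_mul] at this
    refine squeeze_zero (fun l => norm_nonneg _) (fun l => ?_) this
    rw [norm_sub_rev]
    exact hbound l
  · have : 0 ≤ t ^ (2 ^ (l + 1) * r) * ‖φ‖ := by positivity
    linarith
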